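/- Let $k$ be a (unital, associative) ring and let $X$ be a connected and locally simply connected topological space: every point has a basis of open neighbourhoods that are simply connected, where a space is called simply connected if it is connected and each of its coverings is trivial. Let $\operatorname{Shv}_k(X)$ be the category of sheaves of $k$-modules on $X$, and let $i\colon\operatorname{Qcoh}_k(X)\hookrightarrow\operatorname{Shv}_k(X)$ be the inclusion of the full subcategory of quasi-coherent sheaves, i.e. of the sheaves $F$ such that every point has an open neighbourhood $U$ with an exact sequence $k_U^{\oplus I}\to k_U^{\oplus J}\to F|_U\to 0$, where $k_U$ is the constant sheaf and $I,J$ are arbitrary sets. Then $\operatorname{Qcoh}_k(X)$ is an abelian subcategory of $\operatorname{Shv}_k(X)$ (it contains $0$ and is closed under finite products, kernels and cokernels), it has enough injectives, and $i$ has a right adjoint $\operatorname{Qc}\colon\operatorname{Shv}_k(X)\to\operatorname{Qcoh}_k(X)$. Write $D^+(X)$, $D^+(\operatorname{Qcoh}_k(X))$, $D^+(k)$ for the bounded below derived categories of $\operatorname{Shv}_k(X)$, $\operatorname{Qcoh}_k(X)$ and of $k$-modules. Let $$\mathbb R\Gamma\colon D^+(X)\to D^+(k),\qquad \mathbb R_{\rm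 qc}\Gamma\colon D^+(\operatorname{Qcoh}_k(X))\to D^+(k),\qquad \mathbb R\operatorname{Qc}\colon D^+(X)\to D^+(\operatorname{Qcoh}_k(X))$$ be the right derived functors of $\Gamma(X,-)$ on $\operatorname{Shv}_k(X)$, of $\Gamma(X,-)$ restricted to $\operatorname{Qcoh}_k(X)$, and of $\operatorname{Qc}$. Put $H^n(X,F)=H^n(\mathbb R\Gamma F)$ and $R^q\operatorname{Qc}(F)=H^q(\mathbb R\operatorname{Qc}F)$ for $F\in D^+(X)$, and $H^n_{\rm qc}(X,\mathcal L)=H^n(\mathbb R_{\rm qc}\Gamma\,\mathcal L)$ for a quasi-coherent sheaf $\mathcal L$, placed in degree $0$. (1) The counit $i\operatorname{Qc}(F)\to F$ of the adjunction induces an isomorphism $\Gamma(X,\operatorname{Qc}(F))\cong\Gamma(X,F)$, natural in $F\in\operatorname{Shv}_k(X)$, and there is an isomorphism of functors $D^+(X)\to D^+(k)$, $$\mathbb R\Gamma\;\simeq\;\mathbb R_{\rm qc}\Gamma\circ\mathbb R\operatorname{Qc},$$ compatible with it: for every bounded below complex $K$ of sheaves, the composite $\Gamma(X,K)\to\mathbb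 R\Gamma(K)\simeq\mathbb R_{\rm qc}\Gamma(\mathbb R\operatorname{Qc}(K))$ equals the composite $\Gamma(X,K)\cong\Gamma(X,\operatorname{Qc}(K))\to\mathbb R_{\rm qc}\Gamma(\operatorname{Qc}(K))\to\mathbb R_{\rm qc}\Gamma(\mathbb R\operatorname{Qc}(K))$ in $D^+(k)$, the unnamed arrows being induced by the canonical morphisms to the derived functors. (2) For every $F\in D^+(X)$ there is a convergent spectral sequence $$E_2^{p,q}=H^p_{\rm qc}(X,R^q\operatorname{Qc}(F))\;\Rightarrow\;H^{p+q}(X,F)\qquad(p,q\in\mathbb Z),$$ that is, a cohomological $E_2$-spectral sequence of $k$-modules with these terms such that for every $(p,q)$ the differentials to and from $E_r^{p,q}$ vanish for all large $r$, and every $H^n(X,F)$ carries a finite decreasing filtration with $E_\infty^{p,q}\cong F^pH^{p+q}(X,F)/F^{p+1}H^{p+q}(X,F)$. -/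

import Mathlib

open CategoryTheory CategoryTheory.Limits TopologicalSpace Opposite

universe w₁ w₂ w₃ v u

noncomputable section

/-- A space is simply connected if it is connected and every covering of it is trivial, i.e.
isomorphic over the space to the projection from a product with a discrete space. -/
def IsSimplyConnectedSpace (S : Type u) [TopologicalSpace S] : Prop :=
  ConnectedSpace S ∧
    ∀ (E : Type u) [TopologicalSpace E] (p : E → S), IsCoveringMap p →
      ∃ (I : Type u) (_ : TopologicalSpace I) (_ : DiscreteTopology I) (h : E ≃ₜ S × I),
        ∀ e : E, (h e).1 = p e

/-- A space is locally simply connected if every point has a basis of simply connected open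
neighbourhoods. -/
def IsLocallySimplyConnectedSpace (S : Type u) [TopologicalSpace S] : Prop :=
  ∀ (x : S) (U : Opens S), x ∈ U →
    ∃ V : Opens S, x ∈ V ∧ V ≤ U ∧ IsSimplyConnectedSpace V

section Sheaves

variable (k : Type u) [Ring k] (X : TopCat.{u})

/-- The category of sheaves of `k`-modules on `X`. -/
abbrev Shv : Type (u + 1) := TopCat.Sheaf (ModuleCat.{u} k) X

/-- The constant sheaf `k_X`. -/
def constSheaf : Shv k X :=
  (constantSheaf (Opens.grothendieckTopology X) (ModuleCat.{u} k)).obj (ModuleCat.of k k)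

/-- The free sheaf `k_X^{⊕ I}`. -/
def freeSheaf (I : Type u) : Shv k X := ∐ fun _ : I => constSheaf k X

variable {k X} in
/-- The restriction of a sheaf to an open subspace. -/
def restrictSheaf (F : Shv k X) (U : Opens X) : Shv k (TopCat.of U) :=
  U.sheafRestrict.obj F

/-- A sheaf is quasi-coherent if each point has an open neighbourhood `U` with an exact sequence
`k_U^{⊕ I} ⟶ k_U^{⊕ J} ⟶ F|_U ⟶ 0`. -/
def isQuasicoherentSheaf : ObjectProperty (Shv k X) := fun F =>
  ∀ x : X, ∃ (U : Opens X) (_ : x ∈ U) (I J : Type u)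
    (f : freeSheaf k (TopCat.of U) I ⟶ freeSheaf k (TopCat.of U) J)
    (g : freeSheaf k (TopCat.of U) J ⟶ restrictSheaf F U) (zero : f ≫ g = 0),
    (ShortComplex.mk f g zero).Exact ∧ Epi g

/-- The full subcategory of quasi-coherent sheaves. -/
abbrev Qcoh : Type (u + 1) := (isQuasicoherentSheaf k X).FullSubcategory

/-- The inclusion functor of quasi-coherent sheaves into all sheaves. -/
abbrev qcohInclusion : Qcoh k X ⥤ Shv k X := (isQuasicoherentSheaf k X).ι

/-- The global sections functor `Γ(X, -)` on all sheaves. -/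
def globalSections : Shv k X ⥤ ModuleCat.{u} k :=
  (sheafSections (Opens.grothendieckTopology X) (ModuleCat.{u} k)).obj (op ⊤)

instance : (globalSections k X).Additive where
  map_add := rfl

/-- The global sections functor `Γ(X, -)` on quasi-coherent sheaves. -/
abbrev qcGlobalSections : Qcoh k X ⥤ ModuleCat.{u} k := qcohInclusion k X ⋙ globalSections k X

end Sheaves

/-- A full subcategory of an abelian category is an abelian subcategory if it contains zero and is
closed under finite products, kernels and cokernels. Such a subcategory is itself abelian, and its
inclusion is exact. -/
class IsAbelianSubcategory {C : Type u} [Category.{v} C] [Abelian C] (P : ObjectProperty C) :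
    Prop extends P.ContainsZero, P.IsClosedUnderFiniteProducts, P.IsClosedUnderKernels,
      P.IsClosedUnderCokernels

section Derived

variable (k : Type u) [Ring k] (X : TopCat.{u})

/-- The quasicoherator: the right adjoint of the inclusion of quasi-coherent sheaves. -/
def quasicoherator [(qcohInclusion k X).IsLeftAdjoint] : Shv k X ⥤ Qcoh k X :=
  (qcohInclusion k X).rightAdjoint

/-- The adjunction between the inclusion of quasi-coherent sheaves and the quasicoherator. -/
def quasicoheratorAdj [(qcohInclusion k X).IsLeftAdjoint] :
    qcohInclusion k X ⊣ quasicoherator k X :=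
  Adjunction.ofIsLeftAdjoint (qcohInclusion k X)

instance [IsAbelianSubcategory (isQuasicoherentSheaf k X)] [(qcohInclusion k X).IsLeftAdjoint] :
    (quasicoherator k X).Additive :=
  (quasicoheratorAdj k X).right_adjoint_additive

/-- The right derived functor `RΓ : D⁺(X) ⥤ D⁺(k)` of `Γ(X, -)` on all sheaves. -/
abbrev RΓ [HasDerivedCategory.{w₁} (Shv k X)] [HasDerivedCategory.{w₂} (ModuleCat.{u} k)] :
    DerivedCategory.Plus (Shv k X) ⥤ DerivedCategory.Plus (ModuleCat.{u} k) :=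
  (globalSections k X).rightDerivedFunctorPlus

variable [IsAbelianSubcategory (isQuasicoherentSheaf k X)]

/-- The right derived functor `R_qcΓ : D⁺(Qcoh(X)) ⥤ D⁺(k)` of `Γ(X, -)` on quasi-coherent
sheaves. -/
abbrev RqcΓ [EnoughInjectives (Qcoh k X)]
    [HasDerivedCategory.{w₃} (Qcoh k X)] [HasDerivedCategory.{w₂} (ModuleCat.{u} k)] :
    DerivedCategory.Plus (Qcoh k X) ⥤ DerivedCategory.Plus (ModuleCat.{u} k) :=
  (qcGlobalSections k X).rightDerivedFunctorPlus

/-- The right derived functor `RQc : D⁺(X) ⥤ D⁺(Qcoh(X))` of the quasicoherator. -/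
abbrev RQc [(qcohInclusion k X).IsLeftAdjoint]
    [HasDerivedCategory.{w₁} (Shv k X)] [HasDerivedCategory.{w₃} (Qcoh k X)] :
    DerivedCategory.Plus (Shv k X) ⥤ DerivedCategory.Plus (Qcoh k X) :=
  (quasicoherator k X).rightDerivedFunctorPlus

/-- The cohomology modules `Hⁿ(X, F)` of `F` in `D⁺(X)`. -/
abbrev sheafCohomology [HasDerivedCategory.{w₁} (Shv k X)]
    [HasDerivedCategory.{w₂} (ModuleCat.{u} k)]
    (n : ℤ) (F : DerivedCategory.Plus (Shv k X)) : ModuleCat.{u} k :=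
  (DerivedCategory.Plus.homologyFunctor (ModuleCat.{u} k) n).obj ((RΓ k X).obj F)

/-- The quasi-coherent cohomology modules `Hⁿ_qc(X, L)` of a quasi-coherent sheaf `L`, regarded as
a complex concentrated in degree `0`. -/
abbrev qcCohomology [EnoughInjectives (Qcoh k X)]
    [HasDerivedCategory.{w₃} (Qcoh k X)] [HasDerivedCategory.{w₂} (ModuleCat.{u} k)]
    (n : ℤ) (L : Qcoh k X) : ModuleCat.{u} k :=
  (DerivedCategory.Plus.homologyFunctor (ModuleCat.{u} k) n).obj
    ((RqcΓ k X).obj ((DerivedCategory.Plus.singleFunctor (Qcoh k X) 0).obj L))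

/-- The quasi-coherent sheaf `R^q Qc (F)`, for `F` in `D⁺(X)`. -/
abbrev derivedQc [(qcohInclusion k X).IsLeftAdjoint]
    [HasDerivedCategory.{w₁} (Shv k X)] [HasDerivedCategory.{w₃} (Qcoh k X)]
    (q : ℤ) (F : DerivedCategory.Plus (Shv k X)) : Qcoh k X :=
  (DerivedCategory.Plus.homologyFunctor (Qcoh k X) q).obj ((RQc k X).obj F)

end Derived

/-- Convergence of a cohomological `E₂`-spectral sequence `E` to a graded object `H`: each `H n`
carries a finite decreasing filtration, for each position `(p, q)` the differentials to and from
`(p, q)` vanish from some page on, and the object at `(p, q)` of that page (hence of all later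
ones), i.e. the object `E_∞^{p,q}`, is isomorphic to the `p`-th graded piece of `H (p + q)`. -/
structure SpectralSequenceConvergence {C : Type u} [Category.{v} C] [Abelian C]
    (E : E₂CohomologicalSpectralSequence C) (H : ℤ → C) where
  /-- the filtration, `fil n p` being the `p`-th step of the filtration of `H n` -/
  fil (n p : ℤ) : Subobject (H n)
  fil_succ_le (n p : ℤ) : fil n (p + 1) ≤ fil n p
  exists_eq_top (n : ℤ) : ∃ p, fil n p = ⊤
  exists_eq_bot (n : ℤ) : ∃ p, fil n p = ⊥
  /-- a page from which on the object at `(p, q)` is stationary -/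
  stage (p q : ℤ) : ℤ
  two_le_stage (p q : ℤ) : 2 ≤ stage p q
  d_from_eq_zero (p q r : ℤ) (hr : stage p q ≤ r) (pq' : ℤ × ℤ) :
    (E.page r ((two_le_stage p q).trans hr)).d (p, q) pq' = 0
  d_to_eq_zero (p q r : ℤ) (hr : stage p q ≤ r) (pq' : ℤ × ℤ) :
    (E.page r ((two_le_stage p q).trans hr)).d pq' (p, q) = 0
  /-- `E_∞^{p,q}` is the `p`-th graded piece of the filtration of `H (p + q)` -/
  iso (p q : ℤ) :
    (E.page (stage p q) (two_le_stage p q)).X (p, q) ≅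
      cokernel (Subobject.ofLE (fil (p + q) (p + 1)) (fil (p + q) p) (fil_succ_le (p + q) p))

end

/-!
Over a simply connected open set the étale space of a locally constant sheaf is a trivial covering,
so the sheaf is constant there. As the simply connected open sets form a basis of the topology, a
sheaf is quasi-coherent if and only if its restriction maps between simply connected open sets are
isomorphisms, that is, if it comes from a functor on the groupoid obtained from the simply connected
open sets by inverting all inclusions. Right Kan extension to this groupoid is the right adjoint
`Qc` of the inclusion `i`.

As `i` is exact, `Qc` preserves injectives. As constant sheaves are quasi-coherent and `Γ(X, -)` is
right adjoint to the constant sheaf functor, `Γ(X, Qc(F)) ≅ Γ(X, F)`. Together these give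
`RΓ ≅ R_qcΓ ∘ RQc`. The spectral sequence is that of the homology of `R_qcΓ` on the truncations of
`RQc(F)`; it converges because `R_qcΓ` preserves lower bounds.
-/

section Connectedness

lemma eq_of_inter_nonempty_of_isPreconnected {S ι T : Type*} [TopologicalSpace S] {U : Set S}
    (hU : IsPreconnected U) {V : ι → Set S} (hV : ∀ i, IsOpen (V i)) (hUV : U ⊆ ⋃ i, V i)
    {t : ι → T} (ht : ∀ i j, (U ∩ (V i ∩ V j)).Nonempty → t i = t j) {i j : ι}
    (hi : (U ∩ V i).Nonempty) (hj : (U ∩ V j).Nonempty) : t i = t j := by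
  by_contra hij
  obtain ⟨x, hxU, hxA, hxB⟩ := hU (⋃ l ∈ {l | t l = t i}, V l) (⋃ l ∈ {l | t l ≠ t i}, V l)
    (isOpen_biUnion fun l _ => hV l) (isOpen_biUnion fun l _ => hV l)
    (fun x hx => by
      obtain ⟨l, hl⟩ := Set.mem_iUnion.1 (hUV hx)
      exact (em (t l = t i)).imp (fun h => Set.mem_biUnion h hl) fun h => Set.mem_biUnion h hl)
    (hi.mono <| Set.inter_subset_inter_right _ <|
      Set.subset_biUnion_of_mem (u := V) (s := {l | t l = t i}) rfl)
    (hj.mono <| Set.inter_subset_inter_right _ <|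
      Set.subset_biUnion_of_mem (u := V) (s := {l | t l ≠ t i}) (Ne.symm hij))
  obtain ⟨a, ha, hxa⟩ := Set.mem_iUnion₂.1 hxA
  obtain ⟨b, hb, hxb⟩ := Set.mem_iUnion₂.1 hxB
  exact hb ((ht b a ⟨x, hxU, hxb, hxa⟩).trans ha)

lemma IsSimplyConnectedSpace.isConnected {S : Type u} [TopologicalSpace S] {U : Set S}
    (hU : IsSimplyConnectedSpace U) : IsConnected U :=
  isConnected_iff_connectedSpace.2 hU.1

lemma IsSimplyConnectedSpace.exists_continuous_section {S E : Type u} [TopologicalSpace S]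
    [TopologicalSpace E] (hS : IsSimplyConnectedSpace S) {p : E → S} (hp : IsCoveringMap p)
    (e : E) : ∃ σ : S → E, Continuous σ ∧ (∀ y, p (σ y) = y) ∧ σ (p e) = e := by
  obtain ⟨I, _, _, h, hh⟩ := hS.2 E p hp
  refine ⟨fun y => h.symm (y, (h e).2), by fun_prop, fun y => ?_, ?_⟩
  · rw [← hh, h.apply_symm_apply]
  · simp only [← hh, Prod.mk.eta, h.symm_apply_apply]

lemma IsSimplyConnectedSpace.exists_continuous_lift {S E : Type u} [TopologicalSpace S]
    [TopologicalSpace E] {U : Set S} (hU : IsSimplyConnectedSpace U) {p : E → S}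
    (hp : IsCoveringMap p) (e : E) (he : p e ∈ U) :
    ∃ τ : U → E, Continuous τ ∧ (∀ y, p (τ y) = y) ∧ τ ⟨p e, he⟩ = e := by
  obtain ⟨σ, hσ, hpσ, hσe⟩ := hU.exists_continuous_section
    (IsCoveringMapOn.isCoveringMap_restrictPreimage U fun x _ => hp x) ⟨e, he⟩
  exact ⟨fun y => (σ y).1, continuous_subtype_val.comp hσ, fun y => congr(($(hpσ y)).1),
    congr(($hσe).1)⟩

end Connectedness

section ConstantOn

open TopCat.Presheaf

variable {X : TopCat.{v}} {C : Type u} [Category.{v} C] {FC : C → C → Type*} {CC : C → Type v}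
  [∀ A B, FunLike (FC A B) (CC A) (CC B)] [ConcreteCategory.{v} C FC] [HasColimits C]

/-- A presheaf is constant on an open set `U` if its sections over `U` are the same as its germs
at any point of `U`. Over a connected `U`, this means for a sheaf that its restriction to `U` is
isomorphic to a constant sheaf. -/
def IsConstantOn (F : TopCat.Presheaf C X) (U : Opens X) : Prop :=
  ∀ (x : X) (hx : x ∈ U), Function.Bijective (F.germ U x hx)

lemma IsConstantOn.bijective_map {F : TopCat.Presheaf C X} {U V : Opens X}
    (hU : IsConstantOn F U) (hV : IsConstantOn F V) (f : V ⟶ U) (hne : (V : Set X).Nonempty) :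
    Function.Bijective (F.map f.op) := by
  obtain ⟨x, hx⟩ := hne
  rw [← (hV x hx).of_comp_iff']
  convert! hU x (f.le hx) using 1
  exact funext fun s => F.germ_res_apply f x hx s

variable [PreservesFilteredColimits (forget C)]

lemma isOpen_setOf_germ_eq (F : TopCat.Presheaf C X) {U V : Opens X}
    (s : ToType (F.obj (op U))) (t : ToType (F.obj (op V))) :
    IsOpen {x | ∃ (hU : x ∈ U) (hV : x ∈ V), F.germ U x hU s = F.germ V x hV t} := by
  refine isOpen_iff_mem_nhds.2 fun x ⟨hU, hV, h⟩ => ?_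
  obtain ⟨W, hxW, i, j, e⟩ := F.germ_eq x hU hV s t h
  filter_upwards [W.isOpen.mem_nhds hxW] with y hy
  exact ⟨i.le hy, j.le hy, by rw [← F.germ_res_apply i y hy, e, F.germ_res_apply]⟩

lemma continuous_germ (F : TopCat.Presheaf C X) {U : Opens X} (s : ToType (F.obj (op U))) :
    Continuous fun y : U => EtaleSpace.mk y.1 (F.germ U y.1 y.2 s) := by
  refine continuous_generateFrom_iff.2 ?_
  rintro _ ⟨V, t, rfl⟩
  convert! (isOpen_setOf_germ_eq F s t).preimage continuous_subtype_val using 1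
  ext y
  simp

variable [HasLimits C] [PreservesLimits (forget C)] [(forget C).ReflectsIsomorphisms]

/-- The locus where `s` agrees with `φ m` is open, and by `inj` these loci are disjoint for distinct
values of `φ`; as `U` is connected, `s` is one of the `φ m`. -/
lemma IsConstantOn.of_family {F : TopCat.Sheaf C X} {U : Opens X}
    (hU : IsPreconnected (U : Set X)) {M : Type*} (φ : M → ToType (F.obj.obj (op U)))
    (inj : ∀ (x : X) (hx : x ∈ U) (m m' : M),
      F.presheaf.germ U x hx (φ m) = F.presheaf.germ U x hx (φ m') → φ m = φ m')
    (surj : ∀ (x : X) (hx : x ∈ U) (g : ToType (F.presheaf.stalk x)),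
      ∃ m, F.presheaf.germ U x hx (φ m) = g) :
    IsConstantOn F.presheaf U := by
  have hφ (s : ToType (F.obj.obj (op U))) (x : X) (hx : x ∈ U) : ∃ m, φ m = s := by
    choose m hm using fun y : U => surj y y.2 (F.presheaf.germ U y y.2 s)
    refine ⟨m ⟨x, hx⟩, TopCat.Presheaf.section_ext F U _ _ fun y hy => ?_⟩
    rw [← hm ⟨y, hy⟩, eq_of_inter_nonempty_of_isPreconnected (t := fun y => φ (m y)) hU
      (fun y => isOpen_setOf_germ_eq F.presheaf (φ (m y)) s)
      (fun y hy => Set.mem_iUnion.2 ⟨⟨y, hy⟩, hy, hy, hm ⟨y, hy⟩⟩)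
      (fun y z ⟨w, hw, ⟨_, _, h⟩, ⟨_, _, h'⟩⟩ => inj w hw _ _ (h.trans h'.symm))
      (i := ⟨x, hx⟩) (j := ⟨y, hy⟩) ⟨x, hx, hx, hx, hm ⟨x, hx⟩⟩ ⟨y, hy, hy, hy, hm ⟨y, hy⟩⟩]
  refine fun x hx => ⟨fun s t h => ?_, fun g => (surj x hx g).imp' φ fun _ => id⟩
  obtain ⟨m, rfl⟩ := hφ s x hx
  obtain ⟨m', rfl⟩ := hφ t x hx
  exact inj x hx m m' h

lemma exists_germ_eq_of_continuous (F : TopCat.Sheaf C X) {U : Opens X}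
    (g : ∀ y : U, ToType (F.presheaf.stalk y.1))
    (hg : Continuous fun y : U => EtaleSpace.mk y.1 (g y)) :
    ∃ s : ToType (F.obj.obj (op U)), ∀ y : U, F.presheaf.germ U y.1 y.2 s = g y := by
  have hloc (y : U) : ∃ (V : Opens X) (_ : V ≤ U) (_ : y.1 ∈ V) (s : ToType (F.obj.obj (op V))),
      ∀ (z : U) (hz : z.1 ∈ V), F.presheaf.germ V z.1 hz s = g z := by
    obtain ⟨V, -, s, hs⟩ := EtaleSpace.exists_section_of_tendsto (hg.tendsto y)
    obtain ⟨W, hW, hWo, hyW⟩ := mem_nhds_iff.1 hs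
    obtain ⟨W, hWo', rfl⟩ := isOpen_induced_iff.1 hWo
    have hWV : U ⊓ ⟨W, hWo'⟩ ≤ V := fun z hz => (hW (a := ⟨z, hz.1⟩) hz.2).1
    refine ⟨U ⊓ ⟨W, hWo'⟩, inf_le_left, ⟨y.2, hyW⟩, F.obj.map (homOfLE hWV).op s,
      fun z hz => ?_⟩
    exact (F.presheaf.germ_res_apply _ _ hz s).trans (hW hz.2).2.symm
  choose V hVU hyV s hs using hloc
  obtain ⟨t, ht, -⟩ := F.existsUnique_gluing' V U (fun y => homOfLE (hVU y))
    (fun y hy => Opens.mem_iSup.2 ⟨⟨y, hy⟩, hyV ⟨y, hy⟩⟩) s fun y z =>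
      TopCat.Presheaf.section_ext F _ _ _ fun w hw => by
        have hy := F.presheaf.germ_res_apply (Opens.infLELeft (V y) (V z)) w hw (s y)
        have hz := F.presheaf.germ_res_apply (Opens.infLERight (V y) (V z)) w hw (s z)
        exact hy.trans <| (hs y ⟨w, hVU y hw.1⟩ hw.1).trans <|
          (hs z ⟨w, hVU y hw.1⟩ hw.2).symm.trans hz.symm
  refine ⟨t, fun y => ?_⟩
  rw [← hs y y (hyV y), ← ht y]
  exact (F.presheaf.germ_res_apply _ _ _ _).symm

/-- The étale space of `F` is a covering of `X`, so that over `U` its sections are determined by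
their value at one point, and exist through every germ. -/
lemma IsConstantOn.of_isSimplyConnectedSpace {F : TopCat.Sheaf C X}
    (hF : ∀ x, ∃ V : Opens X, x ∈ V ∧ IsConstantOn F.presheaf V) {U : Opens X}
    (hU : IsSimplyConnectedSpace U) : IsConstantOn F.presheaf U := by
  have hp : IsCoveringMap (EtaleSpace.base (F := F.presheaf)) := EtaleSpace.isCoveringMap_base hF
  have : ConnectedSpace U := hU.1
  refine fun x hx => ⟨fun s t hst => ?_, fun g => ?_⟩
  · have hst' := hp.eq_of_comp_eq (continuous_germ F.presheaf s) (continuous_germ F.presheaf t)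
      rfl ⟨x, hx⟩ congr(EtaleSpace.mk x $hst)
    exact TopCat.Presheaf.section_ext F U s t fun y hy => by simpa using congr_fun hst' ⟨y, hy⟩
  · obtain ⟨τ, hτ, hpτ, hτx⟩ := hU.exists_continuous_lift hp ⟨x, g⟩ hx
    obtain ⟨γ, rfl⟩ : ∃ γ : ∀ y : U, ToType (F.presheaf.stalk y.1),
        τ = fun y => EtaleSpace.mk y.1 (γ y) := by
      choose γ hγ using fun y => show ∃ g, τ y = EtaleSpace.mk y.1 g from hpτ y ▸ ⟨_, rfl⟩
      exact ⟨γ, funext hγ⟩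
    obtain ⟨s, hs⟩ := exists_germ_eq_of_continuous F γ hτ
    exact ⟨s, (hs ⟨x, hx⟩).trans (by simpa using hτx)⟩

end ConstantOn

section Presentation

/-- The object `M` is presented by `G` if it is the cokernel of a morphism between coproducts of
copies of `G`. A sheaf is quasi-coherent if it is locally presented by the constant sheaf. -/
def IsPresentedBy {A : Type*} [Category.{v} A] [Abelian A] [HasCoproducts.{u} A] (G M : A) :
    Prop :=
  ∃ (I J : Type u) (f : (∐ fun _ : I => G) ⟶ ∐ fun _ : J => G) (g : (∐ fun _ : J => G) ⟶ M)
    (zero : f ≫ g = 0), (ShortComplex.mk f g zero).Exact ∧ Epi g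

lemma IsPresentedBy.of_exact {A : Type*} [Category.{v} A] [Abelian A] [HasCoproducts.{u} A]
    {S : ShortComplex A} (hS : S.Exact) [Epi S.g] {G M : A} {I J : Type u}
    (e₁ : S.X₁ ≅ ∐ fun _ : I => G) (e₂ : S.X₂ ≅ ∐ fun _ : J => G) (e₃ : S.X₃ ≅ M) :
    IsPresentedBy.{v, u} G M :=
  have zero : (e₁.inv ≫ S.f ≫ e₂.hom) ≫ e₂.inv ≫ S.g ≫ e₃.hom = 0 := by simp
  ⟨I, J, e₁.inv ≫ S.f ≫ e₂.hom, e₂.inv ≫ S.g ≫ e₃.hom, zero,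
    (ShortComplex.exact_iff_of_iso (S₂ := .mk _ _ zero)
      (ShortComplex.isoMk e₁ e₂ e₃ (by simp) (by simp))).1 hS, inferInstance⟩

lemma IsPresentedBy.of_iso {A : Type*} [Category.{v} A] [Abelian A] [HasCoproducts.{u} A]
    {G M N : A} (hM : IsPresentedBy.{v, u} G M) (e : M ≅ N) : IsPresentedBy.{v, u} G N := by
  obtain ⟨I, J, f, g, zero, hfg, _⟩ := hM
  exact .of_exact hfg (Iso.refl _) (Iso.refl _) e

lemma isPresentedBy_of_isSeparator {A : Type*} [Category.{v} A] [Abelian A] [HasCoproducts.{v} A]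
    {G : A} (hG : IsSeparator G) (M : A) : IsPresentedBy.{v, v} G M := by
  let g : (∐ fun _ : G ⟶ M => G) ⟶ M := Sigma.desc fun t => t
  let f : (∐ fun _ : G ⟶ kernel g => G) ⟶ kernel g := Sigma.desc fun t => t
  have hg : Epi g := (isSeparator_iff_epi G).1 hG M
  have hf : Epi f := (isSeparator_iff_epi G).1 hG (kernel g)
  refine ⟨_, _, f ≫ kernel.ι g, g, by simp, ?_, hg⟩
  rw [ShortComplex.exact_iff_epi_kernel_lift]
  convert! hf
  rw [← cancel_mono (kernel.ι g), kernel.lift_ι]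

lemma IsPresentedBy.map {A B : Type*} [Category.{v} A] [Abelian A] [HasCoproducts.{u} A]
    [Category.{w₁} B] [Abelian B] [HasCoproducts.{u} B] {G M : A} (hM : IsPresentedBy.{v, u} G M)
    (L : A ⥤ B) [L.IsLeftAdjoint] : IsPresentedBy.{w₁, u} (L.obj G) (L.obj M) := by
  obtain ⟨I, J, f, g, zero, hfg, _⟩ := hM
  have : PreservesColimitsOfSize.{0, 0} L :=
    (Adjunction.ofIsLeftAdjoint L).leftAdjoint_preservesColimits
  have : PreservesColimitsOfSize.{u, u} L :=
    (Adjunction.ofIsLeftAdjoint L).leftAdjoint_preservesColimits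
  have : Epi ((ShortComplex.mk f g zero).map L).g := inferInstanceAs (Epi (L.map g))
  exact .of_exact (hfg.map_of_epi_of_preservesCokernel L inferInstance inferInstance)
    (PreservesCoproduct.iso L _) (PreservesCoproduct.iso L _) (Iso.refl _)

end Presentation

section ConstantOnTransport

variable {X : TopCat.{v}} {C : Type u} [Category.{v} C] {FC : C → C → Type*} {CC : C → Type v}
  [∀ A B, FunLike (FC A B) (CC A) (CC B)] [ConcreteCategory.{v} C FC] [HasColimits C]

lemma IsConstantOn.of_iso {F G : TopCat.Presheaf C X} {U : Opens X} (hF : IsConstantOn F U)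
    (e : F ≅ G) : IsConstantOn G U := by
  intro x hx
  let eU : F.obj (op U) ≅ G.obj (op U) := e.app (op U)
  let ex : F.stalk x ≅ G.stalk x := (TopCat.Presheaf.stalkFunctor C x).mapIso e
  have hgerm : F.germ U x hx ≫ ex.hom = eU.hom ≫ G.germ U x hx :=
    TopCat.Presheaf.stalkFunctor_map_germ U x hx e.hom
  refine ((MorphismProperty.bijective C).cancel_left_of_respectsIso eU.hom _).1 ?_
  exact hgerm ▸ ((MorphismProperty.bijective C).cancel_right_of_respectsIso _ ex.hom).2 (hF x hx)

lemma isConstantOn_isOpenMap_functor_op_comp_iff {Y : TopCat.{v}} (F : TopCat.Presheaf C X)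
    {f : Y ⟶ X} (hf : Topology.IsOpenEmbedding f) (V : Opens Y) :
    IsConstantOn (hf.functor.op ⋙ F) V ↔ IsConstantOn F (hf.functor.obj V) := by
  let P : AlgebraicGeometry.PresheafedSpace C := ⟨X, F⟩
  have hgerm (y : Y) (hy : y ∈ V) :
      Function.Bijective (TopCat.Presheaf.germ (hf.functor.op ⋙ F) V y hy) ↔
        Function.Bijective (F.germ (hf.functor.obj V) (f y) ⟨y, hy, rfl⟩) :=
    ((MorphismProperty.bijective C).cancel_right_of_respectsIso _
      (P.restrictStalkIso hf y).hom).symm.trans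
      (iff_of_eq congr(MorphismProperty.bijective C $(P.restrictStalkIso_hom_eq_germ hf V y hy)))
  exact ⟨fun h x ⟨y, hy, hyx⟩ => by subst hyx; exact (hgerm y hy).1 (h y hy),
    fun h y hy => (hgerm y hy).2 (h _ _)⟩

end ConstantOnTransport

section ConstantSheaf

variable {k : Type u} [Ring k] {X : TopCat.{u}}

lemma IsConstantOn.of_exact {S : ShortComplex (Shv k X)} (hS : S.Exact) [Epi S.g] {U : Opens X}
    (hU : IsPreconnected (U : Set X)) (h₁ : IsConstantOn S.X₁.presheaf U)
    (h₂ : IsConstantOn S.X₂.presheaf U) : IsConstantOn S.X₃.presheaf U := by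
  let stalk (x : X) : Shv k X ⥤ ModuleCat.{u} k :=
    TopCat.Sheaf.forget _ X ⋙ TopCat.Presheaf.stalkFunctor (ModuleCat.{u} k) x
  have hstalk (x : X) : (S.map (stalk x)).Exact ∧ Epi (S.map (stalk x)).g :=
    ⟨hS.map_of_epi_of_preservesCokernel (stalk x) inferInstance inferInstance,
      inferInstanceAs (Epi ((stalk x).map S.g))⟩
  have hgerm {F G : Shv k X} (f : F ⟶ G) (x : X) (hx : x ∈ U) (s : F.obj.obj (op U)) :
      (stalk x).map f (F.presheaf.germ U x hx s) = G.presheaf.germ U x hx (f.hom.app (op U) s) :=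
    TopCat.Presheaf.stalkFunctor_map_germ_apply U x hx f.hom s
  refine .of_family hU (S.g.hom.app (op U)) (fun x hx m m' h => ?_) fun x hx g => ?_
  · have h0 : (stalk x).map S.g (S.X₂.presheaf.germ U x hx (m - m')) = 0 :=
      (hgerm S.g x hx _).trans <| by rw [map_sub, map_sub]; exact sub_eq_zero_of_eq h
    obtain ⟨a, ha⟩ := (ShortComplex.moduleCat_exact_iff _).1 (hstalk x).1 _ h0
    obtain ⟨a, rfl⟩ := (h₁ x hx).2 a
    have hm : S.f.hom.app (op U) a = m - m' := (h₂ x hx).1 ((hgerm S.f x hx a).symm.trans ha)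
    rw [← sub_eq_zero, ← map_sub, ← hm]
    exact congr(($(S.zero)).hom.app (op U) a)
  · obtain ⟨b, rfl⟩ := (ModuleCat.epi_iff_surjective _).1 (hstalk x).2 g
    obtain ⟨b, rfl⟩ := (h₂ x hx).2 b
    exact ⟨b, (hgerm S.g x hx b).symm⟩

variable (k X) in
/-- The constant sheaf functor. -/
noncomputable def constShv : ModuleCat.{u} k ⥤ Shv k X :=
  constantSheaf (Opens.grothendieckTopology X) (ModuleCat.{u} k)

variable (k X) in
/-- The constant sheaf functor is left adjoint to the global sections functor. -/
noncomputable def constShvAdj : constShv k X ⊣ globalSections k X :=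
  constantSheafAdj _ _ (isTerminalTop : IsTerminal (⊤ : Opens X))

instance : (constShv k X).IsLeftAdjoint := (constShvAdj k X).isLeftAdjoint

lemma isConstantOn_const (M : ModuleCat.{u} k) (U : Opens X) :
    IsConstantOn ((Functor.const (Opens X)ᵒᵖ).obj M) U := by
  intro x hx
  let P : TopCat.Presheaf (ModuleCat.{u} k) X := (Functor.const _).obj M
  refine ⟨fun m m' h => ?_, fun g => ?_⟩
  · obtain ⟨W, _, _, _, e⟩ := P.germ_eq x hx hx m m' h
    exact e
  · obtain ⟨V, hxV, m, rfl⟩ := P.exists_germ_eq g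
    exact ⟨m, (P.germ_res_apply (homOfLE le_top) x hx m).trans
      (P.germ_res_apply (homOfLE (le_top : V ≤ ⊤)) x hxV m).symm⟩

lemma constShvAdj_unit_app (M : ModuleCat.{u} k) : (constShvAdj k X).unit.app M =
    (toSheafify (Opens.grothendieckTopology X) ((Functor.const _).obj M)).app (op ⊤) := by
  simp only [constShvAdj, constantSheafAdj, Adjunction.comp_unit_app]
  rfl

lemma bijective_constShvAdj_unit_app_germ (M : ModuleCat.{u} k) (x : X) :
    Function.Bijective ((constShvAdj k X).unit.app M ≫
      ((constShv k X).obj M).presheaf.germ ⊤ x trivial) := by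
  let P : TopCat.Presheaf (ModuleCat.{u} k) X := (Functor.const _).obj M
  let η : P ⟶ ((constShv k X).obj M).presheaf := toSheafify (Opens.grothendieckTopology X) P
  let ηx : P.stalk x ⟶ ((constShv k X).obj M).presheaf.stalk x :=
    (TopCat.Presheaf.stalkFunctor (ModuleCat.{u} k) x).map η
  have : IsIso ηx :=
    TopCat.Presheaf.stalkFunctor_map_unit_toSheafify_isIso x _ P
  have hgerm : P.germ ⊤ x trivial ≫ ηx = (constShvAdj k X).unit.app M ≫
      ((constShv k X).obj M).presheaf.germ ⊤ x trivial := by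
    rw [constShvAdj_unit_app]
    exact TopCat.Presheaf.stalkFunctor_map_germ ⊤ x trivial η
  exact hgerm ▸ ((MorphismProperty.bijective (ModuleCat.{u} k)).cancel_right_of_respectsIso
    (P.germ ⊤ x trivial) ηx).2 (isConstantOn_const M ⊤ x trivial)

lemma isConstantOn_constShv (M : ModuleCat.{u} k) {U : Opens X}
    (hU : IsPreconnected (U : Set X)) : IsConstantOn ((constShv k X).obj M).presheaf U := by
  let F : TopCat.Presheaf (ModuleCat.{u} k) X := ((constShv k X).obj M).presheaf
  let η : M ⟶ F.obj (op ⊤) := (constShvAdj k X).unit.app M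
  let φ : M ⟶ F.obj (op U) := η ≫ F.map (homOfLE le_top).op
  have hφ (x : X) (hx : x ∈ U) : Function.Bijective (φ ≫ F.germ U x hx) := by
    rw [Category.assoc, F.germ_res]
    exact bijective_constShvAdj_unit_app_germ M x
  exact .of_family hU φ (fun x hx m m' h => congr(φ $((hφ x hx).1 h))) fun x hx => (hφ x hx).2

lemma isIso_constShvAdj_counit_app {F : Shv k X} (hF : IsConstantOn F.presheaf ⊤) :
    IsIso ((constShvAdj k X).counit.app F) := by
  refine (TopCat.Presheaf.isIso_iff_stalkFunctor_map_iso _).2 fun x => ?_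
  let M : ModuleCat.{u} k := F.presheaf.obj (op ⊤)
  let ε : ((constShv k X).obj M).presheaf ⟶ F.presheaf := ((constShvAdj k X).counit.app F).hom
  let εx := (TopCat.Presheaf.stalkFunctor _ x).map ε
  change IsIso εx
  have hgerm : ((constShvAdj k X).unit.app M ≫
      ((constShv k X).obj M).presheaf.germ ⊤ x trivial) ≫ εx = F.presheaf.germ ⊤ x trivial :=
    (Category.assoc _ _ _).trans <|
      congr(_ ≫ $(TopCat.Presheaf.stalkFunctor_map_germ ⊤ x trivial ε)).trans <|
      (Category.assoc _ _ _).symm.trans <|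
      congr($((constShvAdj k X).right_triangle_components F) ≫ F.presheaf.germ ⊤ x trivial).trans
        (Category.id_comp _)
  have hbij : Function.Bijective (εx ∘ ((constShvAdj k X).unit.app M ≫
      ((constShv k X).obj M).presheaf.germ ⊤ x trivial)) := by
    convert! hF x trivial
    rw [← hgerm]
    rfl
  exact (ConcreteCategory.isIso_iff_bijective _).2 <|
    ((bijective_constShvAdj_unit_app_germ M x).of_comp_iff _).1 hbij

end ConstantSheaf

section Quasicoherent

variable {k : Type u} [Ring k] {X : TopCat.{u}}

variable (k) in
lemma isSeparator_moduleCat_of_self : IsSeparator (ModuleCat.of k k) :=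
  have := (isSeparator_iff_faithful_coyoneda_obj _).1 (ModuleCat.isSeparator.{u} k)
  (isSeparator_iff_faithful_coyoneda_obj _).2 <|
    .of_iso (coyoneda.mapIso (Shrink.linearEquiv k k).toModuleIso.symm.op)

lemma isConstantOn_restrictSheaf_iff (F : Shv k X) {U V : Opens X} (h : V ≤ U) :
    IsConstantOn (restrictSheaf F U).presheaf ((Opens.map U.inclusion').obj V) ↔
      IsConstantOn F.presheaf V := by
  refine (isConstantOn_isOpenMap_functor_op_comp_iff F.presheaf U.isOpenEmbedding _).trans ?_
  rw [Opens.functor_map_eq_inf, inf_eq_left.2 h]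

lemma isConstantOn_freeSheaf (I : Type u) {U : Opens X} (hU : IsPreconnected (U : Set X)) :
    IsConstantOn (freeSheaf k X I).presheaf U :=
  (isConstantOn_constShv (∐ fun _ : I => ModuleCat.of k k) hU).of_iso <|
    (TopCat.Sheaf.forget _ X).mapIso
      (PreservesCoproduct.iso (constShv k X) fun _ : I => ModuleCat.of k k)

lemma isPresentedBy_constSheaf {F : Shv k X} (hF : IsConstantOn F.presheaf ⊤) :
    IsPresentedBy.{u, u} (constSheaf k X) F :=
  have := isIso_constShvAdj_counit_app hF
  ((isPresentedBy_of_isSeparator (isSeparator_moduleCat_of_self k) _).map (constShv k X)).of_iso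
    (asIso ((constShvAdj k X).counit.app F))

lemma isQuasicoherentSheaf_of_isConstantOn {F : Shv k X}
    (hF : ∀ x, ∃ U : Opens X, x ∈ U ∧ IsConstantOn F.presheaf U) :
    isQuasicoherentSheaf k X F := by
  intro x
  obtain ⟨U, hxU, hU⟩ := hF x
  rw [← isConstantOn_restrictSheaf_iff F le_rfl, Opens.inclusion'_map_eq_top] at hU
  exact ⟨U, hxU, isPresentedBy_constSheaf hU⟩

variable (hX : IsLocallySimplyConnectedSpace X)
include hX

lemma isConstantOn_of_isQuasicoherentSheaf {F : Shv k X} (hF : isQuasicoherentSheaf k X F)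
    {U : Opens X} (hU : IsSimplyConnectedSpace U) : IsConstantOn F.presheaf U := by
  refine .of_isSimplyConnectedSpace (fun x => ?_) hU
  obtain ⟨U, hxU, I, J, f, g, zero, hfg, _⟩ := hF x
  obtain ⟨V, hxV, hVU, hV⟩ := hX x U hxU
  let V' : Opens (TopCat.of U) := (Opens.map U.inclusion').obj V
  have hV' : IsPreconnected (V' : Set (TopCat.of U)) :=
    hV.isConnected.isPreconnected.preimage_of_isOpenMap Subtype.val_injective
      U.isOpenEmbedding.isOpenMap (by simpa using hVU)
  exact ⟨V, hxV, (isConstantOn_restrictSheaf_iff F hVU).1 (.of_exact hfg hV'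
    (isConstantOn_freeSheaf I hV') (isConstantOn_freeSheaf J hV'))⟩

lemma isConstantOn_of_bijective_map {F : TopCat.Presheaf (ModuleCat.{u} k) X} {U : Opens X}
    (H : ∀ (V : Opens X) (f : V ⟶ U), IsSimplyConnectedSpace V → Function.Bijective (F.map f.op)) :
    IsConstantOn F U := by
  refine fun x hx => ⟨fun s t h => ?_, fun g => ?_⟩
  · obtain ⟨W, hxW, i, j, e⟩ := F.germ_eq x hx hx s t h
    obtain ⟨V, -, hVW, hV⟩ := hX x W hxW
    refine (H V (homOfLE hVW ≫ i) hV).1 ?_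
    have := congr(F.map (homOfLE hVW).op $e)
    rwa [← Functor.map_comp_apply, ← Functor.map_comp_apply] at this
  · obtain ⟨W, hxW, s, rfl⟩ := F.exists_germ_eq g
    obtain ⟨V, hxV, hVW, hV⟩ := hX x (W ⊓ U) ⟨hxW, hx⟩
    obtain ⟨t, ht⟩ := (H V (homOfLE (hVW.trans inf_le_right)) hV).2
      (F.map (homOfLE (hVW.trans inf_le_left)).op s)
    refine ⟨t, ?_⟩
    rw [← F.germ_res_apply (homOfLE (hVW.trans inf_le_right)) x hxV, ht, F.germ_res_apply]

lemma isQuasicoherentSheaf_iff (F : Shv k X) :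
    isQuasicoherentSheaf k X F ↔ ∀ (U V : Opens X) (f : V ⟶ U), IsSimplyConnectedSpace U →
      IsSimplyConnectedSpace V → IsIso (F.obj.map f.op) := by
  refine ⟨fun hF U V f hU hV => (ConcreteCategory.isIso_iff_bijective _).2 <|
      (isConstantOn_of_isQuasicoherentSheaf hX hF hU).bijective_map
        (isConstantOn_of_isQuasicoherentSheaf hX hF hV) f hV.isConnected.nonempty,
    fun H => isQuasicoherentSheaf_of_isConstantOn fun x => ?_⟩
  obtain ⟨U, hxU, -, hU⟩ := hX x ⊤ trivial
  exact ⟨U, hxU, isConstantOn_of_bijective_map hX fun V f hV =>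
    (ConcreteCategory.isIso_iff_bijective _).1 (H U V f hU hV)⟩

end Quasicoherent

section Adjunction

/-- The right adjoint is that of `i ⋙ R`, which has the essential image of the left adjoint `Φ`,
precomposed with `R`. -/
lemma isLeftAdjoint_of_essImage_eq {A B D E : Type*} [Category* A] [Category* B] [Category* D]
    [Category* E] (i : A ⥤ B) (R : B ⥤ E) (Φ : D ⥤ E) [i.Full] [i.Faithful] [R.Full] [R.Faithful]
    [Φ.Full] [Φ.Faithful] [Φ.IsLeftAdjoint] (h : (i ⋙ R).essImage = Φ.essImage) :
    i.IsLeftAdjoint := by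
  have hiR (a : A) : Φ.essImage ((i ⋙ R).obj a) := h ▸ (i ⋙ R).obj_mem_essImage a
  let Ψ : A ⥤ D := Functor.essImage.liftFunctor (i ⋙ R) Φ hiR
  let e : Ψ ⋙ Φ ≅ i ⋙ R := Functor.essImage.liftFunctorCompIso (i ⋙ R) Φ hiR
  have : (Ψ ⋙ Φ).Full := .of_iso e.symm
  have : (Ψ ⋙ Φ).Faithful := .of_iso e.symm
  have : Ψ.Full := .of_comp_faithful Ψ Φ
  have : Ψ.Faithful := .of_comp Ψ Φ
  have : Ψ.EssSurj := ⟨fun d => by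
    obtain ⟨a, ⟨f⟩⟩ : (i ⋙ R).essImage (Φ.obj d) := h ▸ Φ.obj_mem_essImage d
    exact ⟨a, ⟨Φ.preimageIso (e.app a ≪≫ f)⟩⟩⟩
  have : Ψ.IsEquivalence := {}
  have : (i ⋙ R).IsLeftAdjoint := Functor.isLeftAdjoint_of_iso e
  exact ((Adjunction.ofIsLeftAdjoint (i ⋙ R)).restrictFullyFaithful (L := i)
    (R := R ⋙ (i ⋙ R).rightAdjoint) (.id A) (.ofFullyFaithful R) (Functor.leftUnitor _)
    (Functor.rightUnitor _).symm).isLeftAdjoint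

/-- The category of simply connected open subsets. -/
abbrev SimplyConnectedOpens (X : TopCat.{u}) : Type u :=
  ObjectProperty.FullSubcategory fun U : Opens X => IsSimplyConnectedSpace U

namespace SimplyConnectedOpens

variable {X : TopCat.{u}}

variable (X) in
/-- The inclusion of simply connected open subsets. -/
abbrev ι : SimplyConnectedOpens X ⥤ Opens X := ObjectProperty.ι _

variable (hX : IsLocallySimplyConnectedSpace X)
include hX

lemma isCoverDense : (ι X).IsCoverDense (Opens.grothendieckTopology X) := by
  rw [TopCat.Opens.coverDense_iff_isBasis, Opens.isBasis_iff_nbhd]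
  intro U x hx
  obtain ⟨V, hxV, hVU, hV⟩ := hX x U hx
  exact ⟨V, ⟨⟨V, hV⟩, rfl⟩, hxV, hVU⟩

lemma eq_of_compatible {P : (SimplyConnectedOpens X)ᵒᵖ ⥤ Type u}
    (hP : ∀ ⦃U V : SimplyConnectedOpens X⦄ (f : V ⟶ U), Function.Injective (P.map f.op))
    {U : SimplyConnectedOpens X} {S : Sieve U} {s : Presieve.FamilyOfElements P S.arrows}
    (hs : s.Compatible) {V W : SimplyConnectedOpens X} {f : V ⟶ U} {g : W ⟶ U} (hf : S f)
    (hg : S g) {t t' : P.obj (op U)} (ht : P.map f.op t = s f hf) (ht' : P.map g.op t' = s g hg)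
    (hVW : (V.obj ⊓ W.obj : Set X).Nonempty) : t = t' := by
  obtain ⟨x, hx⟩ := hVW
  obtain ⟨T, -, hTVW, hT⟩ := hX x (V.obj ⊓ W.obj) hx
  let T : SimplyConnectedOpens X := ⟨T, hT⟩
  let i : T ⟶ V := ⟨homOfLE (hTVW.trans inf_le_left)⟩
  let j : T ⟶ W := ⟨homOfLE (hTVW.trans inf_le_right)⟩
  apply hP (i ≫ f)
  calc P.map (i ≫ f).op t = P.map i.op (s f hf) := by
        rw [op_comp, Functor.map_comp_apply, ht]
    _ = P.map j.op (s g hg) := hs i j hf hg rfl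
    _ = P.map (j ≫ g).op t' := by rw [op_comp, Functor.map_comp_apply, ht']

lemma isSheaf_of_bijective_map {P : (SimplyConnectedOpens X)ᵒᵖ ⥤ Type u}
    (hP : ∀ ⦃U V : SimplyConnectedOpens X⦄ (f : V ⟶ U), Function.Bijective (P.map f.op)) :
    have := isCoverDense hX
    Presieve.IsSheaf ((ι X).inducedTopology (Opens.grothendieckTopology X)) P := by
  intro _ U S hS s hs
  replace hS := (Functor.mem_inducedTopology_iff_of_isCoverDense _ _ _).1 hS
  let V (i : Σ V, {f : V ⟶ U // S f}) : Set X := i.1.obj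
  have hVU (i) : (U.obj ∩ V i : Set X).Nonempty := by
    obtain ⟨x, hx⟩ := i.1.property.isConnected.nonempty
    exact ⟨x, i.2.1.hom.le hx, hx⟩
  have hcov : (U.obj : Set X) ⊆ ⋃ i, V i := fun x hx => by
    obtain ⟨_, i, ⟨W, f, j, hf, -⟩, hxV⟩ := hS x hx
    exact Set.mem_iUnion.2 ⟨⟨W, f, hf⟩, j.le hxV⟩
  choose t ht using fun i : Σ V, {f : V ⟶ U // S f} => (hP i.2.1).2 (s i.2.1 i.2.2)
  have ht' (i j) : t i = t j :=
    eq_of_inter_nonempty_of_isPreconnected U.property.isConnected.isPreconnected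
      (fun i => i.1.obj.isOpen) hcov (fun i j h => eq_of_compatible hX (fun _ _ f => (hP f).1) hs
        i.2.2 j.2.2 (ht i) (ht j) (h.mono Set.inter_subset_right)) (hVU i) (hVU j)
  obtain ⟨x, hx⟩ := U.property.isConnected.nonempty
  obtain ⟨i, -⟩ := Set.mem_iUnion.1 (hcov hx)
  exact ⟨t i, fun W f hf => by rw [ht' i ⟨W, f, hf⟩]; exact ht ⟨W, f, hf⟩,
    fun t' h => (hP i.2.1).1 ((h _ i.2.2).trans (ht i).symm)⟩

end SimplyConnectedOpens

variable {k : Type u} [Ring k] {X : TopCat.{u}}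

variable (k X) in
/-- The restriction of sheaves to the simply connected open subsets. -/
noncomputable def restrictSimplyConnected :
    Shv k X ⥤ (SimplyConnectedOpens X)ᵒᵖ ⥤ ModuleCat.{u} k :=
  sheafToPresheaf (Opens.grothendieckTopology X) (ModuleCat.{u} k) ⋙
    (Functor.whiskeringLeft _ _ _).obj (SimplyConnectedOpens.ι X).op

variable (hX : IsLocallySimplyConnectedSpace X)
include hX

lemma full_restrictSimplyConnected : (restrictSimplyConnected k X).Full :=
  have := SimplyConnectedOpens.isCoverDense hX
  inferInstanceAs ((SimplyConnectedOpens.ι X).sheafPushforwardContinuous (ModuleCat.{u} k)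
    ((SimplyConnectedOpens.ι X).inducedTopology (Opens.grothendieckTopology X))
    (Opens.grothendieckTopology X) ⋙ sheafToPresheaf _ _).Full

lemma faithful_restrictSimplyConnected : (restrictSimplyConnected k X).Faithful :=
  have := SimplyConnectedOpens.isCoverDense hX
  inferInstanceAs ((SimplyConnectedOpens.ι X).sheafPushforwardContinuous (ModuleCat.{u} k)
    ((SimplyConnectedOpens.ι X).inducedTopology (Opens.grothendieckTopology X))
    (Opens.grothendieckTopology X) ⋙ sheafToPresheaf _ _).Faithful

lemma restrictSimplyConnected_essImage {P : (SimplyConnectedOpens X)ᵒᵖ ⥤ ModuleCat.{u} k}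
    (hP : ∀ ⦃U V : (SimplyConnectedOpens X)ᵒᵖ⦄ (f : U ⟶ V), IsIso (P.map f)) :
    (restrictSimplyConnected k X).essImage P := by
  have := SimplyConnectedOpens.isCoverDense hX
  let J := (SimplyConnectedOpens.ι X).inducedTopology (Opens.grothendieckTopology X)
  have hPJ : Presheaf.IsSheaf J P := by
    rw [Presheaf.isSheaf_iff_isSheaf_forget J P (forget _), isSheaf_iff_isSheaf_of_type]
    refine SimplyConnectedOpens.isSheaf_of_bijective_map hX fun U V f => ?_
    have := hP f.op
    exact ConcreteCategory.bijective_of_isIso (P.map f.op)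
  let Φ := (SimplyConnectedOpens.ι X).sheafPushforwardContinuous (ModuleCat.{u} k) J
    (Opens.grothendieckTopology X)
  obtain ⟨F, ⟨e⟩⟩ := Functor.EssSurj.mem_essImage (F := Φ) ⟨P, hPJ⟩
  exact ⟨F, ⟨(sheafToPresheaf J _).mapIso e⟩⟩

lemma isQuasicoherentSheaf_iff_isInvertedBy (F : Shv k X) : isQuasicoherentSheaf k X F ↔
    (⊤ : MorphismProperty _).IsInvertedBy ((restrictSimplyConnected k X).obj F) :=
  (isQuasicoherentSheaf_iff hX F).trans
    ⟨fun h U V f _ => h _ _ f.unop.hom U.unop.property V.unop.property,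
      fun h U V f hU hV => h (X := op ⟨U, hU⟩) (Y := op ⟨V, hV⟩) (Quiver.Hom.op ⟨f⟩) trivial⟩

lemma essImage_qcohInclusion_comp_restrictSimplyConnected :
    (qcohInclusion k X ⋙ restrictSimplyConnected k X).essImage =
      fun P => (⊤ : MorphismProperty _).IsInvertedBy P := by
  ext P
  refine ⟨fun ⟨F, ⟨e⟩⟩ => (MorphismProperty.IsInvertedBy.iff_of_iso _ e).1 <|
    (isQuasicoherentSheaf_iff_isInvertedBy hX F.obj).1 F.property, fun hP => ?_⟩
  obtain ⟨F, ⟨e⟩⟩ := restrictSimplyConnected_essImage hX fun U V f => hP f trivial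
  exact ⟨⟨F, (isQuasicoherentSheaf_iff_isInvertedBy hX F).2 <|
    (MorphismProperty.IsInvertedBy.iff_of_iso _ e).2 hP⟩, ⟨e⟩⟩

lemma isLeftAdjoint_qcohInclusion : (qcohInclusion k X).IsLeftAdjoint := by
  let W : MorphismProperty (SimplyConnectedOpens X)ᵒᵖ := ⊤
  let Φ : (W.Localization ⥤ ModuleCat.{u} k) ⥤ (SimplyConnectedOpens X)ᵒᵖ ⥤ ModuleCat.{u} k :=
    (Functor.whiskeringLeft _ _ _).obj W.Q
  have := full_restrictSimplyConnected (k := k) hX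
  have := faithful_restrictSimplyConnected (k := k) hX
  have : Φ.Full := Localization.full_whiskeringLeft W.Q W _
  have : Φ.Faithful := Localization.faithful_whiskeringLeft W.Q W _
  have : Φ.IsLeftAdjoint := (W.Q.ranAdjunction (ModuleCat.{u} k)).isLeftAdjoint
  refine isLeftAdjoint_of_essImage_eq _ (restrictSimplyConnected k X) Φ ?_
  rw [essImage_qcohInclusion_comp_restrictSimplyConnected hX]
  ext P
  exact ⟨fun hP => ⟨Localization.lift P hP W.Q, ⟨Localization.fac P hP W.Q⟩⟩,
    fun ⟨G, ⟨e⟩⟩ => (MorphismProperty.IsInvertedBy.iff_of_iso _ e).1 <|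
      (MorphismProperty.Q_inverts W).of_comp _ _ _⟩

end Adjunction

section AbelianSubcategory

lemma isClosedUnderLimitsOfShape_isIso_app {J C D : Type*} [Category* J] [Category* C]
    [Category* D] {G H : C ⥤ D} (τ : G ⟶ H) [PreservesLimitsOfShape J G]
    [PreservesLimitsOfShape J H] :
    ObjectProperty.IsClosedUnderLimitsOfShape (fun X => IsIso (τ.app X)) J where
  limitsOfShape_le X := by
    rintro ⟨p⟩
    let h := isLimitOfPreserves H p.isLimit
    let σ := Functor.whiskerLeft p.diag τ
    have (j : J) : IsIso (σ.app j) := p.prop_diag_obj j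
    have : IsIso σ := NatIso.isIso_of_isIso_app σ
    have e : τ.app X =
        ((isLimitOfPreserves G p.isLimit).conePointsIsoOfNatIso h (asIso σ)).hom :=
      h.hom_ext fun j => by
        rw [IsLimit.conePointsIsoOfNatIso_hom_comp]
        exact (τ.naturality (p.π.app j)).symm
    rw [e]
    infer_instance

variable {k : Type u} [Ring k] {X : TopCat.{u}}

section

variable (hX : IsLocallySimplyConnectedSpace X)
include hX

lemma isClosedUnderLimitsOfShape_isQuasicoherentSheaf (J : Type*) [Category* J]
    [HasLimitsOfShape J (ModuleCat.{u} k)] :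
    (isQuasicoherentSheaf k X).IsClosedUnderLimitsOfShape J where
  limitsOfShape_le F := by
    rintro ⟨p⟩
    refine (isQuasicoherentSheaf_iff hX F).2 fun U V f hU hV => ?_
    let τ := Functor.whiskerLeft
      (sheafToPresheaf (Opens.grothendieckTopology X) (ModuleCat.{u} k))
      ((evaluation _ _).map f.op)
    have := isClosedUnderLimitsOfShape_isIso_app (J := J) τ
    exact ObjectProperty.prop_of_isLimit (fun F => IsIso (τ.app F)) p.isLimit fun j =>
      (isQuasicoherentSheaf_iff hX _).1 (p.prop_diag_obj j) U V f hU hV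

lemma isAbelianSubcategory_isQuasicoherentSheaf :
    IsAbelianSubcategory (isQuasicoherentSheaf k X) where
  exists_zero := by
    have := isClosedUnderLimitsOfShape_isQuasicoherentSheaf (k := k) hX (Discrete PEmpty.{1})
    exact ⟨⊤_ _, (isZero_zero _).of_iso HasZeroObject.zeroIsoTerminal.symm,
      ObjectProperty.prop_limit _ _ (by simp)⟩
  isClosedUnderLimitsOfShape J _ := isClosedUnderLimitsOfShape_isQuasicoherentSheaf hX _
  kernels_le := by
    rintro _ ⟨f, c, hc, hf₁, hf₂⟩
    have := isClosedUnderLimitsOfShape_isQuasicoherentSheaf (k := k) hX WalkingParallelPair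
    exact ObjectProperty.prop_of_isLimit _ hc (by rintro (_ | _) <;> assumption)
  cokernels_le := by
    rintro _ ⟨f, c, hc, hf₁, hf₂⟩
    refine isQuasicoherentSheaf_of_isConstantOn fun x => ?_
    obtain ⟨U, hxU, -, hU⟩ := hX x ⊤ trivial
    have : Epi c.π := Cofork.IsColimit.epi hc
    have hfc : (ShortComplex.mk f c.π c.condition).Exact :=
      ShortComplex.exact_of_g_is_cokernel _
        (IsColimit.ofIsoColimit hc (Cofork.ext (Iso.refl _) (Category.comp_id _)))
    exact ⟨U, hxU, .of_exact hfc hU.isConnected.isPreconnected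
      (isConstantOn_of_isQuasicoherentSheaf hX hf₁ hU)
      (isConstantOn_of_isQuasicoherentSheaf hX hf₂ hU)⟩

end

lemma preservesMonomorphisms_qcohInclusion [IsAbelianSubcategory (isQuasicoherentSheaf k X)] :
    (qcohInclusion k X).PreservesMonomorphisms :=
  have := (isQuasicoherentSheaf k X).preservesKernels_ι
  have := (qcohInclusion k X).preservesFiniteLimits_of_preservesKernels
  inferInstance

section

variable [IsAbelianSubcategory (isQuasicoherentSheaf k X)] [(qcohInclusion k X).IsLeftAdjoint]

lemma enoughInjectives_qcoh : EnoughInjectives (Qcoh k X) :=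
  have := preservesMonomorphisms_qcohInclusion (k := k) (X := X)
  .of_adjunction (quasicoheratorAdj k X)

lemma injective_quasicoherator_obj (I : Shv k X) [Injective I] :
    Injective ((quasicoherator k X).obj I) :=
  have := preservesMonomorphisms_qcohInclusion (k := k) (X := X)
  Injective.injective_of_adjoint (quasicoheratorAdj k X) I

end

end AbelianSubcategory

section GlobalSections

lemma bijective_comp_counit_app {A B : Type*} [Category* A] [Category* B] {i : A ⥤ B} {Q : B ⥤ A}
    [i.Full] [i.Faithful] (adj : i ⊣ Q) {M : B} (hM : i.essImage M) (F : B) :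
    Function.Bijective fun g : M ⟶ i.obj (Q.obj F) => g ≫ adj.counit.app F := by
  obtain ⟨A, ⟨e⟩⟩ := hM
  let φ : (M ⟶ i.obj (Q.obj F)) ≃ (M ⟶ F) := e.symm.homFromEquiv.trans <|
    (Functor.FullyFaithful.ofFullyFaithful i).homEquiv.symm.trans <|
      (adj.homEquiv A F).symm.trans e.homFromEquiv
  have hφ (g) : φ g = g ≫ adj.counit.app F := by
    simp [φ, Adjunction.homEquiv_counit]
  exact funext hφ ▸ φ.bijective

lemma isIso_map_counit_app {A B D : Type*} [Category* A] [Category* B] [Category* D] {i : A ⥤ B}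
    {Q : B ⥤ A} [i.Full] [i.Faithful] (adj : i ⊣ Q) {L : D ⥤ B} {Γ : B ⥤ D} (adj' : L ⊣ Γ)
    (hL : ∀ M, i.essImage (L.obj M)) (F : B) : IsIso (Γ.map (adj.counit.app F)) := by
  refine isIso_of_yoneda_map_bijective _ fun M => ?_
  let φ : (M ⟶ Γ.obj (i.obj (Q.obj F))) ≃ (M ⟶ Γ.obj F) := (adj'.homEquiv M _).symm.trans <|
    (Equiv.ofBijective _ (bijective_comp_counit_app adj (hL M) F)).trans (adj'.homEquiv M F)
  have hφ (g) : φ g = g ≫ Γ.map (adj.counit.app F) := by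
    simp [φ, Adjunction.homEquiv_naturality_right]
  exact funext hφ ▸ φ.bijective

variable {k : Type u} [Ring k] {X : TopCat.{u}} (hX : IsLocallySimplyConnectedSpace X)
include hX

lemma isQuasicoherentSheaf_constShv (M : ModuleCat.{u} k) :
    isQuasicoherentSheaf k X ((constShv k X).obj M) := by
  refine isQuasicoherentSheaf_of_isConstantOn fun x => ?_
  obtain ⟨U, hxU, -, hU⟩ := hX x ⊤ trivial
  exact ⟨U, hxU, isConstantOn_constShv M hU.isConnected.isPreconnected⟩

variable [(qcohInclusion k X).IsLeftAdjoint]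

lemma isIso_globalSections_map_counit_app (F : Shv k X) :
    IsIso ((globalSections k X).map ((quasicoheratorAdj k X).counit.app F)) :=
  isIso_map_counit_app (quasicoheratorAdj k X) (constShvAdj k X)
    (fun M => ⟨⟨_, isQuasicoherentSheaf_constShv hX M⟩, ⟨Iso.refl _⟩⟩) F

variable (k) in
/-- The isomorphism `Γ(X, Qc(F)) ≅ Γ(X, F)` induced by the counit of the quasicoherator. -/
noncomputable def quasicoheratorCompGlobalSectionsIso :
    quasicoherator k X ⋙ qcGlobalSections k X ≅ globalSections k X :=
  have : IsIso (Functor.whiskerRight (quasicoheratorAdj k X).counit (globalSections k X)) :=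
    have (F : Shv k X) : IsIso ((Functor.whiskerRight (quasicoheratorAdj k X).counit
        (globalSections k X)).app F) := isIso_globalSections_map_counit_app hX F
    NatIso.isIso_of_isIso_app _
  asIso (Functor.whiskerRight (quasicoheratorAdj k X).counit (globalSections k X))

end GlobalSections

section RightDerivedComposition

open Functor DerivedCategory.Plus

variable {C D E : Type*} [Category* C] [Category* D] [Category* E] [Abelian C] [Abelian D]
  [Abelian E] [HasDerivedCategory C] [HasDerivedCategory D] [HasDerivedCategory E]
  [EnoughInjectives C] [EnoughInjectives D]
  {F : C ⥤ D} {G : D ⥤ E} {H : C ⥤ E} [F.Additive] [G.Additive] [H.Additive]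

/-- The natural transformation `H ⟶ G ∘ F ⟶ RG ∘ RF` on the homotopy category, for `H ≅ G ∘ F`. -/
noncomputable def rightDerivedFunctorPlusCompUnit (e : F ⋙ G ≅ H) :
    H.mapHomotopyCategoryPlus ⋙ Qh ⟶
      Qh ⋙ F.rightDerivedFunctorPlus ⋙ G.rightDerivedFunctorPlus :=
  whiskerRight (mapHomotopyCategoryPlusCompIso e).inv Qh ≫
    (Functor.associator _ _ _).hom ≫
    whiskerLeft F.mapHomotopyCategoryPlus G.rightDerivedFunctorPlusUnit ≫
    (Functor.associator _ _ _).inv ≫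
    whiskerRight F.rightDerivedFunctorPlusUnit G.rightDerivedFunctorPlus ≫
    (Functor.associator _ _ _).hom

lemma rightDerivedFunctorPlusCompUnit_app (e : F ⋙ G ≅ H) (K : HomotopyCategory.Plus C) :
    (rightDerivedFunctorPlusCompUnit e).app K =
      Qh.map ((mapHomotopyCategoryPlusCompIso e).inv.app K) ≫
        G.rightDerivedFunctorPlusUnit.app (F.mapHomotopyCategoryPlus.obj K) ≫
        G.rightDerivedFunctorPlus.map (F.rightDerivedFunctorPlusUnit.app K) := by
  simp [rightDerivedFunctorPlusCompUnit]

/-- The comparison `RH ⟶ RG ∘ RF`, for `H ≅ G ∘ F`. -/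
noncomputable def rightDerivedFunctorPlusCompHom (e : F ⋙ G ≅ H) :
    H.rightDerivedFunctorPlus ⟶ F.rightDerivedFunctorPlus ⋙ G.rightDerivedFunctorPlus :=
  H.rightDerivedFunctorPlus.rightDerivedDesc H.rightDerivedFunctorPlusUnit
    (HomotopyCategory.Plus.quasiIso C) _ (rightDerivedFunctorPlusCompUnit e)

lemma rightDerivedFunctorPlusUnit_app_comp_compHom (e : F ⋙ G ≅ H) (K : HomotopyCategory.Plus C) :
    H.rightDerivedFunctorPlusUnit.app K ≫ (rightDerivedFunctorPlusCompHom e).app (Qh.obj K) =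
      Qh.map ((mapHomotopyCategoryPlusCompIso e).inv.app K) ≫
        G.rightDerivedFunctorPlusUnit.app (F.mapHomotopyCategoryPlus.obj K) ≫
        G.rightDerivedFunctorPlus.map (F.rightDerivedFunctorPlusUnit.app K) :=
  (rightDerived_fac_app _ _ _ _ _ K).trans (rightDerivedFunctorPlusCompUnit_app e K)

lemma isIso_rightDerivedFunctorPlusCompHom (e : F ⋙ G ≅ H)
    (hF : ∀ (I : C) [Injective I], Injective (F.obj I)) :
    IsIso (rightDerivedFunctorPlusCompHom e) := by
  have (K : DerivedCategory.Plus C) : IsIso ((rightDerivedFunctorPlusCompHom e).app K) := by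
    obtain ⟨K, ⟨f⟩⟩ := EssSurj.mem_essImage
      (F := (InjectiveObject.ι C).mapHomotopyCategoryPlus ⋙ Qh) K
    rw [← NatTrans.isIso_app_iff_of_iso _ f]
    let I := (InjectiveObject.ι C).mapHomotopyCategoryPlus.obj K
    have (n : ℤ) : Injective ((F.mapHomotopyCategoryPlus.obj I).obj.as.X n) :=
      hF (I.obj.as.X n)
    have h := rightDerivedFunctorPlusUnit_app_comp_compHom e I
    rw [← IsIso.eq_inv_comp] at h
    exact h ▸ inferInstance
  exact NatIso.isIso_of_isIso_app _

end RightDerivedComposition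

section TriangulatedRightDerived

open Functor DerivedCategory.Plus

variable (C : Type*) [Category* C] [Abelian C] [HasDerivedCategory C]

/-- The functor `K⁺(Inj(C)) ⥤ D⁺(C)`, which is an equivalence of triangulated categories when `C`
has enough injectives. -/
noncomputable abbrev injectiveToDerivedPlus :
    HomotopyCategory.Plus (InjectiveObject C) ⥤ DerivedCategory.Plus C :=
  (InjectiveObject.ι C).mapHomotopyCategoryPlus ⋙ Qh

lemma injectiveToDerivedPlus_map_bijective (K L : HomotopyCategory.Plus (InjectiveObject C)) :
    Function.Bijective ((injectiveToDerivedPlus C).map : (K ⟶ L) → _) := by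
  obtain ⟨L, hL⟩ := L
  obtain ⟨L, rfl⟩ := HomotopyCategory.quotient_obj_surjective L
  rw [HomotopyCategory.plus_quotient_obj_iff] at hL
  have (L : CochainComplex.Plus (InjectiveObject C)) : CochainComplex.IsKInjective
    (((InjectiveObject.ι C).mapHomologicalComplex (.up ℤ)).obj L.obj) := inferInstance
  exact (Qh_map_bijective_of_isKInjective _ _ (this ⟨L, hL⟩)).comp
    ⟨Functor.map_injective (InjectiveObject.ι C).mapHomotopyCategoryPlus,
      Functor.map_surjective (InjectiveObject.ι C).mapHomotopyCategoryPlus⟩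

instance : (injectiveToDerivedPlus C).Full where
  map_surjective := (injectiveToDerivedPlus_map_bijective C _ _).2

instance : (injectiveToDerivedPlus C).Faithful where
  map_injective := fun h => (injectiveToDerivedPlus_map_bijective C _ _).1 h

variable [EnoughInjectives C]

instance : (injectiveToDerivedPlus C).IsEquivalence where

/-- The functor `D⁺(C) ⥤ K⁺(Inj(C))` of injective resolutions. -/
noncomputable abbrev injectiveResolutionPlus :
    DerivedCategory.Plus C ⥤ HomotopyCategory.Plus (InjectiveObject C) :=
  (injectiveToDerivedPlus C).inv

noncomputable instance : (injectiveResolutionPlus C).CommShift ℤ :=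
  (injectiveToDerivedPlus C).adjunction.rightAdjointCommShift ℤ

instance : (injectiveResolutionPlus C).IsTriangulated :=
  have := (injectiveToDerivedPlus C).adjunction.commShift_of_leftAdjoint ℤ
  (injectiveToDerivedPlus C).adjunction.isTriangulated_rightAdjoint

variable {C} {D : Type*} [Category* D] [Abelian D] [HasDerivedCategory D]
  (F : C ⥤ D) [F.Additive]

/-- The right derived functor is computed by injective resolutions. -/
noncomputable def injectiveResolutionPlusCompIso :
    injectiveResolutionPlus C ⋙ (InjectiveObject.ι C).mapHomotopyCategoryPlus ⋙
      F.mapHomotopyCategoryPlus ⋙ Qh ≅ F.rightDerivedFunctorPlus :=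
  have (K : HomotopyCategory.Plus (InjectiveObject C)) : IsIso ((whiskerLeft
      (InjectiveObject.ι C).mapHomotopyCategoryPlus F.rightDerivedFunctorPlusUnit).app K) :=
    inferInstanceAs (IsIso (F.rightDerivedFunctorPlusUnit.app
      ((InjectiveObject.ι C).mapHomotopyCategoryPlus.obj K)))
  have : IsIso (whiskerLeft (InjectiveObject.ι C).mapHomotopyCategoryPlus
    F.rightDerivedFunctorPlusUnit) := NatIso.isIso_of_isIso_app _
  isoWhiskerLeft _ (asIso (whiskerLeft _ F.rightDerivedFunctorPlusUnit)) ≪≫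
    (Functor.associator _ _ _).symm ≪≫
    isoWhiskerRight (injectiveToDerivedPlus C).asEquivalence.counitIso _ ≪≫ leftUnitor _

noncomputable instance : F.rightDerivedFunctorPlus.CommShift ℤ :=
  .ofIso (injectiveResolutionPlusCompIso F) ℤ

instance : F.rightDerivedFunctorPlus.IsTriangulated :=
  have := CommShift.ofIso_compatibility (injectiveResolutionPlusCompIso F) ℤ
  isTriangulated_of_iso (injectiveResolutionPlusCompIso F)

lemma isGE_rightDerivedFunctorPlus_obj (K : DerivedCategory.Plus C) (n : ℤ) [K.IsGE n] :
    (F.rightDerivedFunctorPlus.obj K).IsGE n := by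
  obtain ⟨L, _, ⟨e⟩⟩ := exists_injective_nonempty_iso K n
  let K' := (HomotopyCategory.Plus.quotient C).obj
    ((InjectiveObject.ι C).mapCochainComplexPlus.obj L)
  have : IsIso (F.rightDerivedFunctorPlusUnit.app K') := inferInstance
  let e' : Qh.obj (F.mapHomotopyCategoryPlus.obj K') ≅ F.rightDerivedFunctorPlus.obj K :=
    asIso (F.rightDerivedFunctorPlusUnit.app K') ≪≫ F.rightDerivedFunctorPlus.mapIso e
  let M : CochainComplex D ℤ := (F.mapHomologicalComplex (.up ℤ)).obj
    (((InjectiveObject.ι C).mapHomologicalComplex (.up ℤ)).obj L.obj)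
  have : M.IsStrictlyGE n := inferInstance
  have : (Qh.obj (F.mapHomotopyCategoryPlus.obj K')).IsGE n := by
    rw [← isGE_ι_obj_iff]
    exact DerivedCategory.TStructure.t.isGE_of_iso
      ((DerivedCategory.quotientCompQhIso D).symm.app M) n
  exact TStructure.t.isGE_of_iso e' n

end TriangulatedRightDerived

section CokernelOfImages

variable {A : Type*} [Category* A] [Abelian A]

lemma exact_ofLE_comp_arrow {H B : A} {w : H ⟶ B} {S T : Subobject H}
    (hS : S = kernelSubobject w) (h : S ≤ T) (zero : S.ofLE T h ≫ T.arrow ≫ w = 0) :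
    (ShortComplex.mk _ _ zero).Exact := by
  refine ShortComplex.exact_of_f_is_kernel _ (KernelFork.IsLimit.ofι' _ _ fun {W} t ht => ?_)
  have ht' : S.Factors (t ≫ T.arrow) := hS ▸ kernelSubobject_factors w _ (by simpa using ht)
  exact ⟨S.factorThru _ ht', by simp [← cancel_mono T.arrow]⟩

/-- If `E` is the image of `u ≫ w` and the image of `v` is the kernel of `w`, then `E` is the
quotient of the image of `u` by the image of `v`. -/
noncomputable def imageCompIsoCokernel {A₀ A₁ H B E : A} {v : A₀ ⟶ H} {u : A₁ ⟶ H} {w : H ⟶ B}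
    {zero : v ≫ w = 0} (hvw : (ShortComplex.mk v w zero).Exact) (e : A₁ ⟶ E) (m : E ⟶ B) [Epi e]
    [Mono m] (fac : e ≫ m = u ≫ w) (h : imageSubobject v ≤ imageSubobject u) :
    E ≅ cokernel (Subobject.ofLE _ _ h) :=
  have hv : imageSubobject v = kernelSubobject w :=
    (ShortComplex.exact_iff_image_eq_kernel _).1 hvw
  have zero' : Subobject.ofLE _ _ h ≫ (imageSubobject u).arrow ≫ w = 0 := by
    rw [Subobject.ofLE_arrow_assoc, ← cancel_epi (factorThruImageSubobject v),
      imageSubobject_arrow_comp_assoc, comp_zero, zero]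
  have : Mono (cokernel.desc _ _ zero') :=
    (ShortComplex.exact_iff_mono_cokernel_desc _).1 (exact_ofLE_comp_arrow hv h zero')
  let e' := factorThruImageSubobject u ≫ cokernel.π (Subobject.ofLE _ _ h)
  have fac' : e' ≫ cokernel.desc _ _ zero' = u ≫ w := by simp [e']
  have : StrongEpi e := strongEpi_of_epi e
  have : Epi e' := epi_comp _ _
  have : StrongEpi e' := strongEpi_of_epi e'
  image.isoStrongEpiMono e m fac ≪≫ (image.isoStrongEpiMono e' _ fac').symm

lemma imageSubobject_eq_top {X Y : A} (f : X ⟶ Y) [Epi f] : imageSubobject f = ⊤ := by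
  have : Epi (imageSubobject f).arrow := epi_of_epi_fac (imageSubobject_arrow_comp f)
  have : IsIso (imageSubobject f).arrow := isIso_of_mono_of_epi _
  exact Subobject.eq_top_of_isIso_arrow _

end CokernelOfImages

section SpectralObjects

variable {C ι A : Type*} [Category* C] [Category* ι] [Category* A] [Abelian A] [HasZeroObject C]
  [HasShift C ℤ] [Preadditive C] [∀ n : ℤ, (shiftFunctor C n).Additive] [Pretriangulated C]

/-- The image of a spectral object in a triangulated category by a homological functor. -/
noncomputable def spectralObjectMapHomologicalFunctor (Y : Triangulated.SpectralObject C ι)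
    (F : C ⥤ A) [F.IsHomological] [F.ShiftSequence ℤ] : Abelian.SpectralObject A ι where
  H n := Y.ω₁ ⋙ F.shift n
  δ' n₀ n₁ h :=
    { app D := F.shiftMap (Y.δ'.app D) n₀ n₁ (by rw [add_comm, h])
      naturality D D' f := by
        have := Y.δ'.naturality f
        dsimp at this ⊢
        rw [← F.shiftMap_comp', this, F.shiftMap_comp] }
  exact₁' n₀ n₁ h D :=
    (F.homologySequence_exact₁ _ (Y.distinguished' D) n₀ n₁ h).exact_toComposableArrows
  exact₂' n D :=
    (F.homologySequence_exact₂ _ (Y.distinguished' D) n).exact_toComposableArrows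
  exact₃' n₀ n₁ h D :=
    (F.homologySequence_exact₃ _ (Y.distinguished' D) n₀ n₁ h).exact_toComposableArrows

end SpectralObjects

section Convergence

open ComposableArrows

variable {A : Type u} [Category.{v} A] [Abelian A]

lemma mk_arrow_comp_mono {C : Type*} [Category* C] {X Y : C} {S T : Subobject X} (h : S ≤ T)
    (f : X ⟶ Y) [Mono f] :
    Subobject.mk (S.arrow ≫ f) ≤ Subobject.mk (T.arrow ≫ f) :=
  Subobject.mk_le_mk_of_comm (S.ofLE T h) (by simp)

/-- The transport of the convergence of a spectral sequence along isomorphisms. -/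
noncomputable def SpectralSequenceConvergence.ofIso {E : E₂CohomologicalSpectralSequence A}
    {H H' : ℤ → A} (h : SpectralSequenceConvergence E H) (e : ∀ n, H n ≅ H' n) :
    SpectralSequenceConvergence E H' where
  fil n p := .mk ((h.fil n p).arrow ≫ (e n).hom)
  fil_succ_le n p := mk_arrow_comp_mono (h.fil_succ_le n p) _
  exists_eq_top n := by
    obtain ⟨p, hp⟩ := h.exists_eq_top n
    have : IsIso (h.fil n p).arrow := (Subobject.isIso_arrow_iff_eq_top _).2 hp
    exact ⟨p, (Subobject.isIso_iff_mk_eq_top _).1 inferInstance⟩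
  exists_eq_bot n := by
    obtain ⟨p, hp⟩ := h.exists_eq_bot n
    refine ⟨p, Subobject.mk_eq_bot_iff_zero.2 ?_⟩
    rw [hp, Subobject.bot_arrow, zero_comp]
  stage := h.stage
  two_le_stage := h.two_le_stage
  d_from_eq_zero := h.d_from_eq_zero
  d_to_eq_zero := h.d_to_eq_zero
  iso p q := h.iso p q ≪≫ cokernel.mapIso _ _ (Subobject.underlyingIso _).symm
    (Subobject.underlyingIso _).symm (by
      rw [← cancel_mono (Subobject.arrow _)]
      simp)

variable (Y : Abelian.SpectralObject A EInt)

/-- The map from `Hⁿ(⊥ ≤ j)` to the abutment `Hⁿ(⊥ ≤ ⊤)`. -/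
noncomputable def toAbutment (n : ℤ) (j : EInt) :
    (Y.H n).obj (mk₁ (homOfLE bot_le : ⊥ ⟶ j)) ⟶
      (Y.H n).obj (mk₁ (homOfLE bot_le : ⊥ ⟶ (⊤ : EInt))) :=
  (Y.H n).map (twoδ₂Toδ₁ (homOfLE bot_le) (homOfLE le_top) _ rfl)

lemma imageSubobject_toAbutment_mono (n : ℤ) {i j : EInt} (h : i ≤ j) :
    imageSubobject (toAbutment Y n i) ≤ imageSubobject (toAbutment Y n j) := by
  have fac : toAbutment Y n i =
      (Y.H n).map (twoδ₂Toδ₁ (homOfLE bot_le) (homOfLE h) _ rfl) ≫ toAbutment Y n j := by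
    rw [toAbutment, toAbutment, ← Functor.map_comp]
    congr 1
  exact fac ▸ imageSubobject_comp_le _ _

/-- The stationary term `E_∞` of index `i ≤ j` is the quotient of successive steps of the
filtration of the abutment. -/
noncomputable def EIsoCokernel (n : ℤ) {i j : EInt} (hij : i ≤ j) :
    Y.E (homOfLE (bot_le : ⊥ ≤ i)) (homOfLE hij) (homOfLE (le_top : j ≤ ⊤)) (n - 1) n (n + 1) ≅
      cokernel (Subobject.ofLE _ _ (imageSubobject_toAbutment_mono Y n hij)) :=
  let f₁ : (⊥ : EInt) ⟶ i := homOfLE bot_le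
  let f₂ : i ⟶ j := homOfLE hij
  let f₃ : j ⟶ ⊤ := homOfLE le_top
  let f₂₃ : i ⟶ ⊤ := homOfLE le_top
  let f₁₂ : ⊥ ⟶ j := homOfLE bot_le
  imageCompIsoCokernel (Y.exact₂ f₁ f₂₃ (homOfLE bot_le) rfl n)
    (Y.toCycles f₁ f₂ f₁₂ rfl n ≫ Y.πE f₁ f₂ f₃ (n - 1) n (n + 1))
    (Y.ιE f₁ f₂ f₃ (n - 1) n (n + 1) ≫ Y.fromOpcycles f₂ f₃ f₂₃ rfl n)
    (by
      rw [Category.assoc, Y.πE_ιE_assoc .., Y.p_fromOpcycles,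
        Y.toCycles_i_assoc, toAbutment, ← Functor.map_comp, ← Functor.map_comp]
      congr 1) _

/-- A spectral object indexed by extended integers is bounded below by `a` if `Hⁿ(i ≤ j)` vanishes
for `n < i` and for `j ≤ a`, as it does for the truncations of a complex in degrees `≥ a`. -/
structure IsBoundedBelowSpectralObject (a : ℤ) : Prop where
  isZero_of_lt {n : ℤ} {i j : EInt} (f : i ⟶ j) (h : ((n + 1 : ℤ) : EInt) ≤ i) :
    IsZero ((Y.H n).obj (mk₁ f))
  isZero_of_le (n : ℤ) {i j : EInt} (f : i ⟶ j) (h : j ≤ (a : ℤ)) :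
    IsZero ((Y.H n).obj (mk₁ f))

namespace IsBoundedBelowSpectralObject

variable {Y} {a : ℤ} (hY : IsBoundedBelowSpectralObject Y a)
include hY

lemma imageSubobject_toAbutment_eq_top {n : ℤ} {j : EInt} (h : ((n + 1 : ℤ) : EInt) ≤ j) :
    imageSubobject (toAbutment Y n j) = ⊤ :=
  have : Epi (toAbutment Y n j) :=
    (Y.exact₂ _ _ _ rfl n).epi_f ((hY.isZero_of_lt _ h).eq_of_tgt _ _)
  imageSubobject_eq_top _

lemma imageSubobject_toAbutment_eq_bot (n : ℤ) {j : EInt} (h : j ≤ (a : ℤ)) :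
    imageSubobject (toAbutment Y n j) = ⊥ := by
  rw [(hY.isZero_of_le n _ h).eq_of_src (toAbutment Y n j) 0, imageSubobject_zero]

/-- The terms `E` of a spectral object do not change when its extreme indices are replaced by
`⊥` and `⊤` beyond the bounds. -/
noncomputable def EIso (n : ℤ) {b i j c : EInt} (hbi : b ≤ i) (hij : i ≤ j)
    (hjc : j ≤ c) (hb : b ≤ (a : ℤ)) (hc : ((n : ℤ) : EInt) ≤ c) :
    Y.E (homOfLE hbi) (homOfLE hij) (homOfLE hjc) (n - 1) n (n + 1) ≅
      Y.E (homOfLE (bot_le : ⊥ ≤ i)) (homOfLE hij) (homOfLE (le_top : j ≤ ⊤)) (n - 1) n (n + 1) :=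
  (Y.isoMapFourδ₁Toδ₀' ⊥ b i j c bot_le hbi hij hjc (n - 1) n (n + 1)
      (hY.isZero_of_le _ _ hb)).symm ≪≫
    Y.isoMapFourδ₄Toδ₃' ⊥ i j c ⊤ bot_le hij hjc le_top (n - 1) n (n + 1)
      (hY.isZero_of_lt _ (by simpa using hc))

lemma d_from_eq_zero {p q r : ℤ} (h₂ : 2 ≤ r) (hr : q + 2 - a ≤ r) (pq' : ℤ × ℤ) :
    (Y.E₂SpectralSequence.page r h₂).d (p, q) pq' = 0 := by
  by_cases h : (ComplexShape.up' (⟨r, 1 - r⟩ : ℤ × ℤ)).Rel (p, q) pq'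
  · obtain rfl := h
    exact (Y.isZero_spectralSequence_page_X_of_isZero_H' _ r h₂ _ <|
      hY.isZero_of_le _ _ (by simp; lia)).eq_of_tgt _ _
  · exact HomologicalComplex.shape _ _ _ h

lemma d_to_eq_zero {p q r : ℤ} (h₂ : 2 ≤ r) (hr : p + 1 ≤ r) (pq' : ℤ × ℤ) :
    (Y.E₂SpectralSequence.page r h₂).d pq' (p, q) = 0 := by
  by_cases h : (ComplexShape.up' (⟨r, 1 - r⟩ : ℤ × ℤ)).Rel pq' (p, q)
  · obtain ⟨h₄, h₅⟩ := Prod.ext_iff.1 h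
    dsimp at h₄ h₅
    exact (Y.isZero_spectralSequence_page_X_of_isZero_H' _ r h₂ _ <|
      hY.isZero_of_lt _ (by simp; lia)).eq_of_src _ _
  · exact HomologicalComplex.shape _ _ _ h

/-- The identification of `E_r^{p,q}` for large `r` with a graded piece of the abutment. -/
noncomputable def pageXIso {p q r : ℤ} (h₂ : 2 ≤ r) (hr : q + 2 - a ≤ r) (hr' : p + 1 ≤ r) :
    (Y.E₂SpectralSequence.page r h₂).X (p, q) ≅
      cokernel (Subobject.ofLE _ _ (imageSubobject_toAbutment_mono Y (p + q)
        (show ((p + q - (p + 1) + 1 : ℤ) : EInt) ≤ ((p + q - p + 1 : ℤ) : EInt) by simp))) :=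
  Y.spectralSequencePageXIso Abelian.SpectralObject.coreE₂Cohomological _ h₂ (p, q) _ _ _ _ rfl
      (by simp) (by simp) rfl (p + q - 1) (p + q) (p + q + 1) rfl ≪≫
    hY.EIso (p + q) (b := (q - r + 2 : ℤ)) (c := (q + r - 1 : ℤ)) (by simp; lia) _ (by simp; lia)
      (by simp; lia) (by simp; lia) ≪≫ EIsoCokernel Y (p + q) _

/-- The `E₂`-spectral sequence of a bounded below spectral object converges. The differential
from `E_r^{p,q}` vanishes when its target `E_r^{p+r,q-r+1}` lies below the row `a`, and the
differential to it when its source lies left of the column `0`. -/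
noncomputable def convergence : SpectralSequenceConvergence Y.E₂SpectralSequence
    fun n => (Y.H n).obj (mk₁ (homOfLE bot_le : ⊥ ⟶ (⊤ : EInt))) :=
  have two_le_stage (p q : ℤ) : 2 ≤ max 2 (max (q + 2 - a) (p + 1)) := le_max_left _ _
  have row_le_stage (p q : ℤ) : q + 2 - a ≤ max 2 (max (q + 2 - a) (p + 1)) := by simp
  have column_le_stage (p q : ℤ) : p + 1 ≤ max 2 (max (q + 2 - a) (p + 1)) := by simp
  { fil n p := imageSubobject (toAbutment Y n ((n - p + 1 : ℤ) : EInt))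
    fil_succ_le n p := imageSubobject_toAbutment_mono Y n (by simp; lia)
    exists_eq_top n := ⟨0, hY.imageSubobject_toAbutment_eq_top (by simp)⟩
    exists_eq_bot n := ⟨n + 1 - a, hY.imageSubobject_toAbutment_eq_bot n (by simp; lia)⟩
    stage p q := max 2 (max (q + 2 - a) (p + 1))
    two_le_stage
    d_from_eq_zero p q r hr pq' := hY.d_from_eq_zero _ ((row_le_stage p q).trans hr) pq'
    d_to_eq_zero p q r hr pq' := hY.d_to_eq_zero _ ((column_le_stage p q).trans hr) pq'
    iso p q := hY.pageXIso _ (row_le_stage p q) (column_le_stage p q) }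

end IsBoundedBelowSpectralObject

end Convergence

section HomologicalFunctors

open Pretriangulated

variable {C A : Type*} [Category* C] [Category* A] [Abelian A] [HasZeroObject C]
  [HasShift C ℤ] [Preadditive C] [∀ n : ℤ, (shiftFunctor C n).Additive] [Pretriangulated C]
  (F : C ⥤ A) [F.IsHomological] {T : Triangle C}

lemma isIso_homological_map_mor₂ (hT : T ∈ distTriang C)
    (h₁ : IsZero (F.obj T.obj₁)) (h₂ : IsZero (F.obj (T.obj₁⟦(1 : ℤ)⟧))) :
    IsIso (F.map T.mor₂) := by
  have : Mono (F.map T.mor₂) := (F.map_distinguished_exact _ hT).mono_g (h₁.eq_of_src _ _)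
  have : Epi (F.map T.mor₂) := (F.map_distinguished_exact _
    (rot_of_distTriang _ hT)).epi_f (h₂.eq_of_tgt _ _)
  exact isIso_of_mono_of_epi _

lemma isIso_homological_map_mor₁ (hT : T ∈ distTriang C)
    (h₁ : IsZero (F.obj T.obj₃)) (h₂ : IsZero (F.obj (T.obj₃⟦(-1 : ℤ)⟧))) :
    IsIso (F.map T.mor₁) := by
  have : Epi (F.map T.mor₁) := (F.map_distinguished_exact _ hT).epi_f (h₁.eq_of_tgt _ _)
  have : Mono (F.map T.mor₁) := (F.map_distinguished_exact _
    (inv_rot_of_distTriang _ hT)).mono_g (h₂.eq_of_src _ _)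
  exact isIso_of_mono_of_epi _

end HomologicalFunctors

section Truncations

open DerivedCategory.Plus DerivedCategory.Plus.TStructure

variable {C : Type*} [Category* C] [Abelian C] [HasDerivedCategory C]
  (K : DerivedCategory.Plus C) (n : ℤ)

lemma isIso_homologyFunctor_map_truncGEπ :
    IsIso ((homologyFunctor C n).map ((t.truncGEπ n).app K)) := by
  have : IsLE (((t.truncLT n).obj K)⟦(1 : ℤ)⟧) (n - 2) := t.isLE_shift _ (n - 1) 1 (n - 2)
  exact isIso_homological_map_mor₂ _ (t.triangleLTGE_distinguished n K)
    (isZero_homology_of_isLE ((t.truncLT n).obj K) (n - 1) n (by lia))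
    (isZero_homology_of_isLE (((t.truncLT n).obj K)⟦(1 : ℤ)⟧) (n - 2) n (by lia))

lemma isIso_homologyFunctor_map_truncLTι :
    IsIso ((homologyFunctor C n).map ((t.truncLTι (n + 1)).app K)) := by
  have : IsGE (((t.truncGE (n + 1)).obj K)⟦(-1 : ℤ)⟧) (n + 2) :=
    t.isGE_shift _ (n + 1) (-1) (n + 2)
  exact isIso_homological_map_mor₁ _ (t.triangleLTGE_distinguished (n + 1) K)
    (isZero_homology_of_isGE ((t.truncGE (n + 1)).obj K) (n + 1) n (by lia))
    (isZero_homology_of_isGE (((t.truncGE (n + 1)).obj K)⟦(-1 : ℤ)⟧) (n + 2) n (by lia))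

lemma nonempty_iso_singleFunctor_obj_homology [K.IsGE n] [K.IsLE n] :
    Nonempty (K ≅ (singleFunctor C n).obj ((homologyFunctor C n).obj K)) := by
  obtain ⟨M, ⟨e⟩⟩ := (ι.obj K).exists_iso_singleFunctor_obj_of_isGE_of_isLE n
  have e_homology : (homologyFunctor C n).obj K ≅ M :=
    (DerivedCategory.homologyFunctor C n).mapIso e ≪≫
      (DerivedCategory.singleFunctorCompHomologyFunctorIso C n).app M
  let e_single : K ≅ (singleFunctor C n).obj M := ι.preimageIso (Y := (singleFunctor C n).obj M) e
  exact ⟨e_single ≪≫ (singleFunctor C n).mapIso e_homology.symm⟩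

/-- The truncation of a complex to the degree `n` keeps its homology in that degree. -/
noncomputable def homologyTruncGELTIso :
    (homologyFunctor C n).obj ((t.truncGE n).obj ((t.truncLT (n + 1)).obj K)) ≅
      (homologyFunctor C n).obj K :=
  have := isIso_homologyFunctor_map_truncGEπ ((t.truncLT (n + 1)).obj K) n
  have := isIso_homologyFunctor_map_truncLTι K n
  (asIso ((homologyFunctor C n).map ((t.truncGEπ n).app ((t.truncLT (n + 1)).obj K)))).symm ≪≫
    asIso ((homologyFunctor C n).map ((t.truncLTι (n + 1)).app K))

lemma nonempty_truncGE_truncLT_iso_shift_single :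
    Nonempty ((t.truncGE n).obj ((t.truncLT (n + 1)).obj K) ≅
      ((singleFunctor C 0).obj ((homologyFunctor C n).obj K))⟦-n⟧) := by
  have : IsLE ((t.truncLT (n + 1)).obj K) n := t.isLE_of_le _ (n + 1 - 1) n
  have : IsLE ((t.truncGE n).obj ((t.truncLT (n + 1)).obj K)) n := inferInstance
  obtain ⟨e⟩ := nonempty_iso_singleFunctor_obj_homology
    ((t.truncGE n).obj ((t.truncLT (n + 1)).obj K)) n
  exact ⟨e ≪≫ (singleFunctor C n).mapIso (homologyTruncGELTIso K n) ≪≫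
    (((singleFunctors C).shiftIso (-n) n 0 (by lia)).app _).symm⟩

end Truncations

section GrothendieckSpectralSequence

open DerivedCategory.Plus DerivedCategory.Plus.TStructure

variable {C : Type*} [Category* C] [Abelian C] [EnoughInjectives C] [HasDerivedCategory C]
  {D : Type u} [Category.{v} D] [Abelian D] [HasDerivedCategory D]
  (F : C ⥤ D) [F.Additive] (K : DerivedCategory.Plus C)

/-- The spectral object of the homology of `RF` on the truncations of `K`, whose spectral sequence
is the hypercohomology spectral sequence of `F`. -/
noncomputable def hypercohomologySpectralObject : Abelian.SpectralObject D EInt :=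
  spectralObjectMapHomologicalFunctor
    ((t.spectralObject K).mapTriangulatedFunctor F.rightDerivedFunctorPlus) (homologyFunctor D 0)

lemma isBoundedBelow_hypercohomologySpectralObject (a : ℤ) [K.IsGE a] :
    IsBoundedBelowSpectralObject (hypercohomologySpectralObject F K) a where
  isZero_of_lt {n i j} _ h :=
    let T := (t.eTruncGE.obj i).obj ((t.eTruncLT.obj j).obj K)
    have : T.IsGE (n + 1) := t.isGE_eTruncGE_obj_obj (n + 1) i h _
    have := isGE_rightDerivedFunctorPlus_obj F T (n + 1)
    isZero_homology_of_isGE (F.rightDerivedFunctorPlus.obj T) (n + 1) n (by lia)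
  isZero_of_le n i j _ h :=
    (homologyFunctor D n).map_isZero <| F.rightDerivedFunctorPlus.map_isZero <|
      (t.eTruncGE.obj i).map_isZero (t.isZero_eTruncLT_obj_obj K a j h)

lemma nonempty_hypercohomology_secondPage_X_iso (p q : ℤ) :
    Nonempty (((hypercohomologySpectralObject F K).E₂SpectralSequence.page 2 le_rfl).X (p, q) ≅
      (homologyFunctor D p).obj (F.rightDerivedFunctorPlus.obj
        ((singleFunctor C 0).obj ((homologyFunctor C q).obj K)))) := by
  obtain ⟨e⟩ := nonempty_truncGE_truncLT_iso_shift_single K q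
  exact ⟨(hypercohomologySpectralObject F K).spectralSequenceFirstPageXIso
      Abelian.SpectralObject.coreE₂Cohomological (p, q) q (q + 1 : ℤ) rfl rfl (p + q) rfl ≪≫
    (homologyFunctor D (p + q)).mapIso (F.rightDerivedFunctorPlus.mapIso e ≪≫
      (F.rightDerivedFunctorPlus.commShiftIso (-q)).app _) ≪≫
    ((homologyFunctor D 0).shiftIso (-q) (p + q) p (by lia)).app _⟩

lemma nonempty_hypercohomologySpectralSequence_convergence :
    Nonempty (SpectralSequenceConvergence
      (hypercohomologySpectralObject F K).E₂SpectralSequence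
      fun n => (homologyFunctor D n).obj (F.rightDerivedFunctorPlus.obj K)) := by
  obtain ⟨a, ha⟩ := K.property
  have : K.IsGE a := (isGE_ι_obj_iff K a).1 ha
  exact ⟨(isBoundedBelow_hypercohomologySpectralObject F K a).convergence⟩

end GrothendieckSpectralSequence

theorem mainTheorem8_general (k : Type u) [Ring k] (X : TopCat.{u})
    (hX : IsLocallySimplyConnectedSpace X)
    [HasDerivedCategory.{w₁} (Shv k X)] [HasDerivedCategory.{w₂} (ModuleCat.{u} k)] :
    ∃ (_ : IsAbelianSubcategory (isQuasicoherentSheaf k X))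
      (_ : EnoughInjectives (Qcoh k X))
      (_ : (qcohInclusion k X).IsLeftAdjoint),
    ∀ [HasDerivedCategory.{w₃} (Qcoh k X)],
      (∃ (e₀ : quasicoherator k X ⋙ qcGlobalSections k X ≅ globalSections k X)
          (e : RΓ k X ≅ RQc k X ⋙ RqcΓ k X),
        (∀ F : Shv k X, e₀.hom.app F =
          (globalSections k X).map ((quasicoheratorAdj k X).counit.app F)) ∧
        ∀ K : HomotopyCategory.Plus (Shv k X),
          (globalSections k X).rightDerivedFunctorPlusUnit.app K ≫
              e.hom.app (DerivedCategory.Plus.Qh.obj K) =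
            DerivedCategory.Plus.Qh.map
                ((Functor.mapHomotopyCategoryPlusCompIso e₀).inv.app K) ≫
              (qcGlobalSections k X).rightDerivedFunctorPlusUnit.app
                ((quasicoherator k X).mapHomotopyCategoryPlus.obj K) ≫
              (RqcΓ k X).map ((quasicoherator k X).rightDerivedFunctorPlusUnit.app K)) ∧
      (∀ F : DerivedCategory.Plus (Shv k X),
        ∃ E : E₂CohomologicalSpectralSequence (ModuleCat.{u} k),
          (∀ p q : ℤ, Nonempty ((E.page 2 le_rfl).X (p, q) ≅
            qcCohomology k X p (derivedQc k X q F))) ∧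
          Nonempty (SpectralSequenceConvergence E fun n => sheafCohomology k X n F)) := by
  have hQ := isAbelianSubcategory_isQuasicoherentSheaf (k := k) hX
  have hL := isLeftAdjoint_qcohInclusion (k := k) hX
  have hI := enoughInjectives_qcoh (k := k) (X := X)
  refine ⟨hQ, hI, hL, ?_⟩
  intro _
  let e₀ := quasicoheratorCompGlobalSectionsIso k hX
  have := isIso_rightDerivedFunctorPlusCompHom e₀ injective_quasicoherator_obj
  let e : RΓ k X ≅ RQc k X ⋙ RqcΓ k X := asIso (rightDerivedFunctorPlusCompHom e₀)
  refine ⟨⟨e₀, e, fun F => rfl, rightDerivedFunctorPlusUnit_app_comp_compHom e₀⟩, fun F => ?_⟩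
  let L := (RQc k X).obj F
  obtain ⟨convergence⟩ :=
    nonempty_hypercohomologySpectralSequence_convergence (qcGlobalSections k X) L
  exact ⟨_, nonempty_hypercohomology_secondPage_X_iso (qcGlobalSections k X) L,
    ⟨convergence.ofIso fun n =>
      (DerivedCategory.Plus.homologyFunctor _ n).mapIso (e.app F).symm⟩⟩

theorem mainTheorem8 (k : Type u) [Ring k] (X : TopCat.{u}) [ConnectedSpace X]
    (hX : IsLocallySimplyConnectedSpace X)
    [HasDerivedCategory.{w₁} (Shv k X)] [HasDerivedCategory.{w₂} (ModuleCat.{u} k)] :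
    -- the objects in the statement exist
    ∃ (_ : IsAbelianSubcategory (isQuasicoherentSheaf k X))
      (_ : EnoughInjectives (Qcoh k X))
      (_ : (qcohInclusion k X).IsLeftAdjoint),
    ∀ [HasDerivedCategory.{w₃} (Qcoh k X)],
      -- the natural isomorphism, compatible with the units of the derived functors
      (∃ (e₀ : quasicoherator k X ⋙ qcGlobalSections k X ≅ globalSections k X)
          (e : RΓ k X ≅ RQc k X ⋙ RqcΓ k X),
        (∀ F : Shv k X, e₀.hom.app F =
          (globalSections k X).map ((quasicoheratorAdj k X).counit.app F)) ∧
        ∀ K : HomotopyCategory.Plus (Shv k X),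
          (globalSections k X).rightDerivedFunctorPlusUnit.app K ≫
              e.hom.app (DerivedCategory.Plus.Qh.obj K) =
            DerivedCategory.Plus.Qh.map
                ((Functor.mapHomotopyCategoryPlusCompIso e₀).inv.app K) ≫
              (qcGlobalSections k X).rightDerivedFunctorPlusUnit.app
                ((quasicoherator k X).mapHomotopyCategoryPlus.obj K) ≫
              (RqcΓ k X).map ((quasicoherator k X).rightDerivedFunctorPlusUnit.app K)) ∧
      -- the convergent spectral sequence
      (∀ F : DerivedCategory.Plus (Shv k X),
        ∃ E : E₂CohomologicalSpectralSequence (ModuleCat.{u} k),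
          (∀ p q : ℤ, Nonempty ((E.page 2 le_rfl).X (p, q) ≅
            qcCohomology k X p (derivedQc k X q F))) ∧
          Nonempty (SpectralSequenceConvergence E fun n => sheafCohomology k X n F)) :=
  mainTheorem8_general k X hX
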